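/- All graphs are finite, simple and undirected. The Fibonacci index $F(G)$ of a graph $G$ is the number of its stable sets (sets of pairwise non-adjacent vertices), including the empty set, and the stability number $\alpha(G)$ is the maximum size of a stable set of $G$. For integers $1\le\alpha\le n-1$, and also for $n=\alpha=1$, the Turán-connected graph $TC(n,\alpha)$ is the graph on $n$ vertices, unique up to isomorphism, obtained from a disjoint union of $\alpha$ cliques, each of order $\lceil n/\alpha\rceil$ or $\lfloor n/\alpha\rfloor$, by choosing a vertex $v$ in a clique of order $\lceil n/\alpha\rceil$ and adding $\alpha-1$ edges that join $v$ to one vertex of each of the other cliques. Thus $TC(1,1)=K_1$. Put $f_{TC}(n,\alpha)=F(TC(n,\alpha))$, and let $C_5$ be the cycle on $5$ vertices. **Theorem.** Let $G$ be a connected graph of order $n\ge 1$ with stability number $\alpha$. Then $$F(G)\le f_{TC}(n,\alpha).$$ If $(n,\alpha)\ne(5,2)$, equality holds if and only if $G\cong TC(n,\alpha)$. If $(n,\alpha)=(5,2)$, equality holds if and only if $G\cong TC(5,2)$ or $G\cong C_5$. -/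

import Mathlib

/-- The Fibonacci index of a graph: the number of its stable (independent) sets of vertices,
the empty set included. -/
noncomputable def fibonacciIndex {V : Type*} (G : SimpleGraph V) : ℕ :=
  Nat.card {s : Finset V // G.IsIndepSet (s : Set V)}

/-- The union of `α` disjoint balanced cliques on `n` vertices. Its cliques are the residue classes
modulo `α` in `{0, …, n - 1}`; it is the complement of Mathlib's `turanGraph`, which is
complete multipartite with these same classes. -/
def turanCliques (n α : ℕ) : SimpleGraph (Fin n) :=
  (SimpleGraph.turanGraph n α)ᶜ

/-- The Turán-connected graph: to the union of `α` balanced cliques we add `α - 1` edges that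
join the vertex `0`, which lies in a clique of the largest size `⌈n / α⌉`, to one vertex of
each other clique, namely to the vertices `1, …, α - 1`. -/
def turanConnected (n α : ℕ) : SimpleGraph (Fin n) :=
  turanCliques n α ⊔ SimpleGraph.fromRel fun v w => (v : ℕ) = 0 ∧ (w : ℕ) < α

/-- The Fibonacci index of the Turán-connected graph. -/
noncomputable def fTC (n α : ℕ) : ℕ :=
  fibonacciIndex (turanConnected n α)

/-! The engine is the recurrence F(G) = F(G - v) + F(G - N[v]). Write n = m + 1, α = b + 1 and m =
q(b + 1) + t with t ≤ b.

Without connectivity, a greedy argument gives a vertex of degree at least q, and the recurrence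
yields by induction the Turán-type bound F(G) ≤ `turanCount n α`, attained only by disjoint unions
of balanced cliques (`stableCount_le_turanCount`, `exists_isCliqueColoring`).

For connected graphs the induction is on the order and then on the edge set. If deleting some edge
keeps α and connectivity, the smaller graph has strictly more stable sets. If deleting it keeps α
but disconnects, the edge is a bridge and α is additive over the two sides. The bounds for the sides
combine, and hanging all cliques on a single hub is at least as good as joining two hubs
(`turanConnectedCount_join`, `join_bound`).

Otherwise every edge deletion raises α. Suppose α ≥ 2. An exchange argument shows that no vertex is
a cut vertex, and α(G - v) = α, so induction applies to G - v for every v. A vertex of degree above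
q then gives a strict inequality. If there is none, the greedy argument forces G to be q-regular
with t = 0; the bound still holds, and equality makes the non-neighbours of every vertex a disjoint
union of q-cliques, which leaves only the pentagon (`critical_bound`, `isPentagonOn_of_regular`).

In the remaining equality cases some vertex v attains both Turán-connected values, for F(G - v) and
for F(G - N[v]). Uniqueness in the Turán-type bound and connectivity then recover the star of
cliques, which is determined up to isomorphism (`exists_isCliqueStar`, `IsCliqueStar.nonempty_iso`).
-/

/-! ### Arithmetic of the extremal counts -/

/-- The number of stable sets of the disjoint union of `a` balanced cliques on `n` vertices. -/
def turanCount (n a : ℕ) : ℕ := ∏ i ∈ Finset.range a, ((n + i) / a + 1)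

/-- The number of stable sets of the Turán-connected graph on `m + 1` vertices with `b + 1` cliques
that contain the hub. -/
def hubCount (m b : ℕ) : ℕ :=
  (m / (b + 1)) ^ (b - m % (b + 1)) * (m / (b + 1) + 1) ^ (m % (b + 1))

/-- The number of stable sets of the Turán-connected graph on `m + 1` vertices with `b + 1`
cliques. -/
def turanConnectedCount (m b : ℕ) : ℕ := turanCount m (b + 1) + hubCount m b

theorem turanCount_mono {n n' : ℕ} (a : ℕ) (h : n ≤ n') : turanCount n a ≤ turanCount n' a := by
  unfold turanCount
  gcongr

theorem turanCount_pos (n a : ℕ) : 0 < turanCount n a :=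
  Finset.prod_pos fun _ _ => Nat.succ_pos _

@[simp] theorem turanCount_zero_right (n : ℕ) : turanCount n 0 = 1 := by simp [turanCount]

@[simp] theorem turanCount_one_right (n : ℕ) : turanCount n 1 = n + 1 := by simp [turanCount]

/-- The factor with index i counts a clique of order ⌊(n + i)/a⌋, which is q for the first a - r
indices and q + 1 for the rest. The case r = a is allowed, so a multiple of a can be written with
either quotient. -/
theorem turanCount_eq (q a r : ℕ) (h : r ≤ a) :
    turanCount (q * a + r) a = (q + 1) ^ (a - r) * (q + 2) ^ r := by
  obtain ⟨s, rfl⟩ := Nat.exists_eq_add_of_le' h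
  unfold turanCount
  rw [Finset.prod_range_add]
  congr 1
  · rw [Finset.prod_congr rfl (g := fun _ => q + 1)]
    · simp
    · intro i hi
      rw [Finset.mem_range] at hi
      have : (q * (s + r) + r + i) / (s + r) = q := by
        rw [add_assoc, mul_comm, Nat.mul_add_div (by omega), Nat.div_eq_of_lt (by omega)]; rfl
      rw [this]
  · rw [Finset.prod_congr rfl (g := fun _ => q + 2)]
    · simp
    · intro i hi
      rw [Finset.mem_range] at hi
      have : (q * (s + r) + r + (s + i)) / (s + r) = q + 1 := by
        rw [show q * (s + r) + r + (s + i) = (s + r) * (q + 1) + i by ring,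
          Nat.mul_add_div (by omega), Nat.div_eq_of_lt (by omega)]
      rw [this]

theorem hubCount_eq (q b t : ℕ) (h : t ≤ b) :
    hubCount (q * (b + 1) + t) b = q ^ (b - t) * (q + 1) ^ t := by
  unfold hubCount
  have h1 : (q * (b + 1) + t) / (b + 1) = q := by
    rw [mul_comm, Nat.mul_add_div (by omega), Nat.div_eq_of_lt (by omega)]; rfl
  have h2 : (q * (b + 1) + t) % (b + 1) = t := by
    rw [mul_comm, Nat.mul_add_mod, Nat.mod_eq_of_lt (by omega)]
  rw [h1, h2]

/-- This is the vertex recurrence at a vertex of a clique of largest order `m / (b + 1) + 1`: its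
removal leaves a balanced family, and so does the removal of its whole clique. -/
theorem turanCount_succ (m b : ℕ) :
    turanCount (m + 1) (b + 1) = turanCount m (b + 1) + turanCount (m - m / (b + 1)) b := by
  obtain ⟨q, t, ht, rfl⟩ : ∃ q t, t ≤ b ∧ m = q * (b + 1) + t :=
    ⟨m / (b + 1), m % (b + 1), Nat.lt_succ_iff.1 (Nat.mod_lt _ (by omega)),
      (Nat.div_add_mod' _ _).symm⟩
  have h1 : (q * (b + 1) + t) / (b + 1) = q := by
    rw [mul_comm, Nat.mul_add_div (by omega), Nat.div_eq_of_lt (by omega)]; rfl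
  rw [h1, show q * (b + 1) + t - q = q * b + t by rw [mul_add, mul_one]; omega, add_assoc,
    turanCount_eq q (b + 1) (t + 1) (by omega), turanCount_eq q (b + 1) t (by omega),
    turanCount_eq q b t ht, show b + 1 - t = b - t + 1 by omega,
    show b + 1 - (t + 1) = b - t by omega]
  ring

theorem turanCount_lt_succ (m b : ℕ) : turanCount m (b + 1) < turanCount (m + 1) (b + 1) := by
  rw [turanCount_succ]
  exact Nat.lt_add_of_pos_right (turanCount_pos _ _)

theorem turanCount_strictMono (b : ℕ) : StrictMono fun m => turanCount m (b + 1) :=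
  strictMono_nat_of_lt_succ fun m => turanCount_lt_succ m b

@[simp] theorem turanCount_zero_left (a : ℕ) : turanCount 0 a = 1 := by
  simpa using turanCount_eq 0 a 0 (by omega)

/-- Apply the recurrence to the first family and to the merged one. The hypothesis `h` says that the
second family has average clique order at most q₁ + 1, so the clique deleted from the merged family
is no larger than the one deleted from the first, and the merged family keeps at least as many
vertices. -/
theorem turanCount_mul_le_step (m₁ b₁ n₂ a₂ : ℕ)
    (IH : ∀ n₁ n₂' a₁ a₂, n₁ + n₂' < m₁ + 1 + n₂ →
      turanCount n₁ a₁ * turanCount n₂' a₂ ≤ turanCount (n₁ + n₂') (a₁ + a₂))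
    (h : n₂ ≤ (m₁ / (b₁ + 1) + 1) * a₂) :
    turanCount (m₁ + 1) (b₁ + 1) * turanCount n₂ a₂ ≤
      turanCount (m₁ + 1 + n₂) (b₁ + 1 + a₂) := by
  have hq := Nat.div_mul_le_self m₁ (b₁ + 1)
  have hq' := Nat.div_le_self m₁ (b₁ + 1)
  have hm : m₁ < (m₁ / (b₁ + 1) + 1) * (b₁ + 1) := Nat.lt_mul_of_div_lt (by omega) (by omega)
  set q₁ := m₁ / (b₁ + 1)
  have key : (m₁ + n₂) / (b₁ + a₂ + 1) ≤ q₁ := by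
    rw [← Nat.lt_succ_iff, Nat.div_lt_iff_lt_mul (by omega)]
    calc m₁ + n₂ < (q₁ + 1) * (b₁ + 1) + (q₁ + 1) * a₂ := add_lt_add_of_lt_of_le hm h
      _ = _ := by rw [Nat.succ_eq_add_one]; ring
  rw [show m₁ + 1 + n₂ = (m₁ + n₂) + 1 by ring, show b₁ + 1 + a₂ = (b₁ + a₂) + 1 by ring,
    turanCount_succ, turanCount_succ, add_mul]
  have e1 := IH m₁ n₂ (b₁ + 1) a₂ (by omega)
  have e2 := IH (m₁ - q₁) n₂ b₁ a₂ (by have := Nat.sub_le m₁ q₁; clear_value q₁; clear key hq; omega)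
  rw [show b₁ + 1 + a₂ = (b₁ + a₂) + 1 by ring] at e1
  refine add_le_add e1 (e2.trans (turanCount_mono _ ?_))
  clear_value q₁
  generalize (m₁ + n₂) / (b₁ + a₂ + 1) = x at *
  omega

/-- Rebalancing the cliques of two families together does not lose stable sets. The induction
deletes a vertex from the family with the larger quotient, as `turanCount_mul_le_step` requires. -/
theorem turanCount_mul_le (n₁ n₂ a₁ a₂ : ℕ) :
    turanCount n₁ a₁ * turanCount n₂ a₂ ≤ turanCount (n₁ + n₂) (a₁ + a₂) := by
  induction hn : n₁ + n₂ using Nat.strong_induction_on generalizing n₁ n₂ a₁ a₂ with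
  | _ n IH =>
  subst hn
  have IH' : ∀ m₁ m₂ a₁ a₂, m₁ + m₂ < n₁ + n₂ →
      turanCount m₁ a₁ * turanCount m₂ a₂ ≤ turanCount (m₁ + m₂) (a₁ + a₂) :=
    fun m₁ m₂ a₁ a₂ h => IH _ h m₁ m₂ a₁ a₂ rfl
  rcases a₁ with _ | b₁
  · simpa using turanCount_mono a₂ (Nat.le_add_left n₂ n₁)
  rcases a₂ with _ | b₂
  · simpa using turanCount_mono (b₁ + 1) (Nat.le_add_right n₁ n₂)
  rcases n₁ with _ | m₁
  · rcases n₂ with _ | m₂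
    · simp
    · have := turanCount_mul_le_step m₂ b₂ 0 (b₁ + 1)
        (fun x y z w h => IH' x y z w (by omega)) (by omega)
      rwa [mul_comm, add_comm 0, add_comm (b₁ + 1)]
  rcases n₂ with _ | m₂
  · exact turanCount_mul_le_step m₁ b₁ 0 (b₂ + 1) (fun x y z w h => IH' x y z w (by omega))
      (by omega)
  rcases le_total (m₂ / (b₂ + 1)) (m₁ / (b₁ + 1)) with h | h
  · refine turanCount_mul_le_step m₁ b₁ (m₂ + 1) (b₂ + 1)
      (fun x y z w h => IH' x y z w (by omega)) ?_
    exact (Nat.lt_mul_of_div_lt (Nat.lt_succ_of_le h) (by omega) : m₂ < _)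
  · rw [mul_comm, add_comm (m₁ + 1), add_comm (b₁ + 1)]
    refine turanCount_mul_le_step m₂ b₂ (m₁ + 1) (b₁ + 1)
      (fun x y z w h => IH' x y z w (by omega)) ?_
    exact (Nat.lt_mul_of_div_lt (Nat.lt_succ_of_le h) (by omega) : m₁ < _)

theorem prod_succ_le_turanCount {ι : Type*} (J : Finset ι) (s : ι → ℕ) :
    ∏ i ∈ J, (s i + 1) ≤ turanCount (∑ i ∈ J, s i) J.card := by
  classical
  induction J using Finset.induction_on with
  | empty => simp
  | insert a J ha ih =>
    rw [Finset.prod_insert ha, Finset.sum_insert ha, Finset.card_insert_of_notMem ha,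
      add_comm J.card]
    refine le_trans (Nat.mul_le_mul_left _ ih) ?_
    simpa using turanCount_mul_le (s a) (∑ i ∈ J, s i) 1 J.card

/-- A family whose product is as large as possible for its sum is balanced. -/
theorem le_succ_of_prod_succ_eq {ι : Type*} {J : Finset ι} {s : ι → ℕ}
    (h : ∏ i ∈ J, (s i + 1) = turanCount (∑ i ∈ J, s i) J.card) {i j : ι} (hi : i ∈ J)
    (hj : j ∈ J) : s i ≤ s j + 1 := by
  classical
  by_contra! hlt
  have hij : i ≠ j := by rintro rfl; omega
  have hj' : j ∈ J.erase i := Finset.mem_erase.2 ⟨hij.symm, hj⟩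
  -- Moving one unit from i to j keeps the sum and strictly increases the product when the values
  -- differ by at least 2, contrary to the maximality of the product.
  set s' := Function.update (Function.update s i (s i - 1)) j (s j + 1)
  have hs' : ∀ x ∈ (J.erase i).erase j, s' x = s x := by
    intro x hx
    simp only [Finset.mem_erase] at hx
    simp [s', hx.1, hx.2.1]
  have hs'i : s' i = s i - 1 := by simp [s', hij]
  have hs'j : s' j = s j + 1 := by simp [s']
  have h1 := prod_succ_le_turanCount J s'
  rw [← Finset.mul_prod_erase J _ hi, ← Finset.mul_prod_erase _ _ hj',
    ← Finset.add_sum_erase J _ hi, ← Finset.add_sum_erase _ _ hj',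
    Finset.prod_congr rfl (fun x hx => by rw [hs' x hx]), Finset.sum_congr rfl hs', hs'i, hs'j,
    show s i - 1 + (s j + 1 + ∑ x ∈ (J.erase i).erase j, s x) =
      s i + (s j + ∑ x ∈ (J.erase i).erase j, s x) by omega,
    Finset.add_sum_erase _ _ hj', Finset.add_sum_erase _ _ hi, ← h,
    ← Finset.mul_prod_erase J _ hi, ← Finset.mul_prod_erase _ _ hj', ← mul_assoc, ← mul_assoc] at h1
  have hpos : 0 < ∏ x ∈ (J.erase i).erase j, (s x + 1) := Finset.prod_pos fun _ _ => Nat.succ_pos _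
  have h2 := Nat.le_of_mul_le_mul_right h1 hpos
  obtain ⟨d, hd⟩ := Nat.exists_eq_add_of_lt hlt
  rw [hd, show s j + 1 + d + 1 - 1 + 1 = s j + d + 2 by omega] at h2
  nlinarith

/-- The non-neighbours of the hub are b balanced cliques, each without its representative: the hub's
clique accounts for q vertices besides the hub, the representatives for b. For m < b the left side
would be 0 and the right side positive. -/
theorem hubCount_eq_turanCount {m b : ℕ} (h : b ≤ m) :
    hubCount m b = turanCount (m - m / (b + 1) - b) b := by
  obtain ⟨q, t, ht, rfl⟩ : ∃ q t, t ≤ b ∧ m = q * (b + 1) + t :=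
    ⟨m / (b + 1), m % (b + 1), Nat.lt_succ_iff.1 (Nat.mod_lt _ (by omega)),
      (Nat.div_add_mod' _ _).symm⟩
  have h1 : (q * (b + 1) + t) / (b + 1) = q := by
    rw [mul_comm, Nat.mul_add_div (by omega), Nat.div_eq_of_lt (by omega)]; rfl
  rw [h1, hubCount_eq q b t ht]
  rcases q with _ | q
  · obtain rfl : t = b := by omega
    simp
  · rw [show (q + 1) * (b + 1) + t - (q + 1) - b = q * b + t by
      rw [show (q + 1) * (b + 1) + t = q * b + t + b + (q + 1) by ring]; omega,
      turanCount_eq q b t ht]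

theorem hubCount_pos {m b : ℕ} (h : b ≤ m) : 0 < hubCount m b := by
  rw [hubCount_eq_turanCount h]
  exact turanCount_pos _ _

/-- The count obtained by deleting a vertex of degree at least `q + 1`. -/
theorem turanConnectedCount_large_degree (q b t : ℕ) (ht : t ≤ b) (hq : 1 ≤ q) (hb : 1 ≤ b) :
    turanConnectedCount (q * (b + 1) + t - 1) b + turanCount (q * b + t - 1) b <
      turanConnectedCount (q * (b + 1) + t) b := by
  unfold turanConnectedCount
  -- For t = 0 the order m - 1 has quotient q - 1 and remainder b, so this case needs separate
  -- formulas.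
  rcases t with _ | t
  · obtain ⟨q, rfl⟩ := Nat.exists_eq_add_of_le' hq
    obtain ⟨c, rfl⟩ := Nat.exists_eq_add_of_le' hb
    rw [show (q + 1) * (c + 1 + 1) + 0 - 1 = q * (c + 1 + 1) + (c + 1) by
        rw [add_mul]; omega,
      show (q + 1) * (c + 1) + 0 - 1 = q * (c + 1) + c by rw [add_mul]; omega,
      turanCount_eq q _ (c + 1) (by omega), turanCount_eq q _ c (by omega),
      turanCount_eq (q + 1) _ 0 (by omega), hubCount_eq q _ _ le_rfl,
      hubCount_eq (q + 1) _ 0 (by omega)]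
    simp only [Nat.sub_zero, pow_zero, mul_one, Nat.sub_self, Nat.add_sub_cancel_left, pow_one,
      one_mul, show c + 1 + 1 - (c + 1) = 1 by omega]
    have : 0 < (q + 2) ^ c := by positivity
    rw [show q + 1 + 1 = q + 2 by ring, pow_succ (q + 2) (c + 1), pow_succ (q + 2) c]
    nlinarith
  · rw [show q * (b + 1) + (t + 1) - 1 = q * (b + 1) + t by omega,
      show q * b + (t + 1) - 1 = q * b + t by omega, turanCount_eq q _ t (by omega),
      turanCount_eq q _ (t + 1) (by omega), turanCount_eq q _ t (by omega),
      hubCount_eq q _ t (by omega), hubCount_eq q _ (t + 1) (by omega)]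
    obtain ⟨e, rfl⟩ := Nat.exists_eq_add_of_le' ht
    rw [show e + (t + 1) + 1 - t = e + 2 by omega, show e + (t + 1) - t = e + 1 by omega,
      show e + (t + 1) + 1 - (t + 1) = e + 1 by omega, show e + (t + 1) - (t + 1) = e by omega]
    -- The `turanCount` terms cancel exactly; the surplus on the right comes from the hub terms and
    -- equals this positive number.
    have : 0 < q ^ e * (q + 1) ^ t := by positivity
    ring_nf at this ⊢
    nlinarith

/-- The count obtained by deleting a vertex of degree `q` when the cliques other than that of the
hub have order `q`. -/
theorem turanConnectedCount_small_degree (q b : ℕ) (hq : 1 ≤ q) :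
    turanConnectedCount (q * (b + 1) - 1) b + turanCount (q * b) b =
      turanConnectedCount (q * (b + 1)) b := by
  unfold turanConnectedCount
  obtain ⟨q, rfl⟩ := Nat.exists_eq_add_of_le' hq
  have h1 := turanCount_eq (q + 1) (b + 1) 0 (by omega)
  have h2 := turanCount_eq (q + 1) b 0 (by omega)
  have h3 := hubCount_eq (q + 1) b 0 (by omega)
  rw [add_zero] at h1 h2 h3
  rw [h1, h2, h3, show (q + 1) * (b + 1) - 1 = q * (b + 1) + b by rw [add_mul]; omega,
    turanCount_eq q _ b (by omega), hubCount_eq q _ _ le_rfl]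
  simp only [Nat.sub_zero, Nat.sub_self, show b + 1 - b = 1 by omega]
  ring

theorem div_add_le {m b : ℕ} (h : b ≤ m) : m / (b + 1) + b ≤ m := by
  rcases Nat.eq_zero_or_pos (m / (b + 1)) with h0 | h0
  · omega
  · have := Nat.div_mul_le_self m (b + 1)
    nlinarith

/-- The left side counts the stable sets through the first hub once all b₂ + 1 cliques of the second
graph hang on it: each of them loses one vertex, which leaves m₂ + 1 - (b₂ + 1) vertices.
Rebalancing then gives the right side. -/
theorem hubCount_mul_le {m₁ b₁ m₂ b₂ : ℕ} (h₁ : b₁ ≤ m₁) (h₂ : b₂ ≤ m₂)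
    (hk : m₂ / (b₂ + 1) ≤ m₁ / (b₁ + 1)) :
    hubCount m₁ b₁ * turanCount (m₂ - b₂) (b₂ + 1) ≤
      hubCount (m₁ + m₂ + 1) (b₁ + b₂ + 1) := by
  have hdiv : (m₁ + m₂ + 1) / (b₁ + b₂ + 1 + 1) ≤ m₁ / (b₁ + 1) := by
    rw [← Nat.lt_succ_iff, Nat.div_lt_iff_lt_mul (by omega)]
    have e1 := Nat.lt_mul_of_div_lt (Nat.lt_succ_self (m₁ / (b₁ + 1))) (Nat.succ_pos b₁)
    have e2 := Nat.lt_mul_of_div_lt (Nat.lt_succ_of_le hk) (Nat.succ_pos b₂)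
    calc m₁ + m₂ + 1 < (m₁ / (b₁ + 1)).succ * b₁.succ + (m₁ / (b₁ + 1)).succ * b₂.succ := by
          rw [add_assoc]; exact add_lt_add_of_lt_of_le e1 e2
      _ = _ := by simp only [Nat.succ_eq_add_one]; ring
  rw [hubCount_eq_turanCount h₁, hubCount_eq_turanCount (by omega)]
  refine (turanCount_mul_le _ _ _ _).trans ?_
  rw [show b₁ + (b₂ + 1) = b₁ + b₂ + 1 by ring]
  refine turanCount_mono _ ?_
  have := div_add_le h₁
  generalize m₁ / (b₁ + 1) = x at *
  generalize (m₁ + m₂ + 1) / (b₁ + b₂ + 1 + 1) = y at *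
  omega

/-- Hanging all cliques on one hub is better than joining two hubs. -/
theorem turanConnectedCount_join {m₁ b₁ m₂ b₂ : ℕ} (h₁ : b₁ ≤ m₁) (h₂ : b₂ ≤ m₂)
    (hk : m₂ / (b₂ + 1) ≤ m₁ / (b₁ + 1)) :
    turanCount m₁ (b₁ + 1) * turanConnectedCount m₂ b₂ +
        hubCount m₁ b₁ * turanCount m₂ (b₂ + 1) ≤ turanConnectedCount (m₁ + m₂ + 1) (b₁ + b₂ + 1) ∧
    (turanCount m₁ (b₁ + 1) * turanConnectedCount m₂ b₂ +
        hubCount m₁ b₁ * turanCount m₂ (b₂ + 1) =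
          turanConnectedCount (m₁ + m₂ + 1) (b₁ + b₂ + 1) →
      b₂ = 0 ∨ (b₁ = 0 ∧ m₁ / (b₁ + 1) = m₂ / (b₂ + 1))) := by
  have hA : turanCount m₁ (b₁ + 1) * turanCount (m₂ + 1) (b₂ + 1) ≤
      turanCount (m₁ + m₂ + 1) (b₁ + b₂ + 1 + 1) := by
    have := turanCount_mul_le m₁ (m₂ + 1) (b₁ + 1) (b₂ + 1)
    rwa [show m₁ + (m₂ + 1) = m₁ + m₂ + 1 by ring,
      show b₁ + 1 + (b₂ + 1) = b₁ + b₂ + 1 + 1 by ring] at this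
  have hB := hubCount_mul_le h₁ h₂ hk
  obtain ⟨q₁, t₁, ht₁, rfl⟩ : ∃ q t, t ≤ b₁ ∧ m₁ = q * (b₁ + 1) + t :=
    ⟨m₁ / (b₁ + 1), m₁ % (b₁ + 1), Nat.lt_succ_iff.1 (Nat.mod_lt _ (by omega)),
      (Nat.div_add_mod' _ _).symm⟩
  obtain ⟨q₂, t₂, ht₂, rfl⟩ : ∃ q t, t ≤ b₂ ∧ m₂ = q * (b₂ + 1) + t :=
    ⟨m₂ / (b₂ + 1), m₂ % (b₂ + 1), Nat.lt_succ_iff.1 (Nat.mod_lt _ (by omega)),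
      (Nat.div_add_mod' _ _).symm⟩
  have d₁ : (q₁ * (b₁ + 1) + t₁) / (b₁ + 1) = q₁ := by
    rw [mul_comm, Nat.mul_add_div (by omega), Nat.div_eq_of_lt (by omega)]; rfl
  have d₂ : (q₂ * (b₂ + 1) + t₂) / (b₂ + 1) = q₂ := by
    rw [mul_comm, Nat.mul_add_div (by omega), Nat.div_eq_of_lt (by omega)]; rfl
  rw [d₁, d₂] at hk ⊢
  -- P₁ and P₂ count the stable sets of the cliques other than the hub's; the hub counts are the
  -- same products with every factor lowered by one.
  set P₁ := (q₁ + 1) ^ (b₁ - t₁) * (q₁ + 2) ^ t₁ with hP₁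
  set P₂ := (q₂ + 1) ^ (b₂ - t₂) * (q₂ + 2) ^ t₂ with hP₂
  have a₁ : turanCount (q₁ * (b₁ + 1) + t₁) (b₁ + 1) = (q₁ + 1) * P₁ := by
    rw [turanCount_eq _ _ _ (by omega), show b₁ + 1 - t₁ = b₁ - t₁ + 1 by omega]; ring
  have a₂ : turanCount (q₂ * (b₂ + 1) + t₂) (b₂ + 1) = (q₂ + 1) * P₂ := by
    rw [turanCount_eq _ _ _ (by omega), show b₂ + 1 - t₂ = b₂ - t₂ + 1 by omega]; ring
  have c₂ : turanCount (q₂ * (b₂ + 1) + t₂ + 1) (b₂ + 1) = (q₂ + 2) * P₂ := by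
    rw [add_assoc, turanCount_eq _ _ _ (by omega), show b₂ + 1 - (t₂ + 1) = b₂ - t₂ by omega]; ring
  have u₁ := hubCount_eq q₁ b₁ t₁ ht₁
  have u₂ := hubCount_eq q₂ b₂ t₂ ht₂
  have v₂ : turanCount (q₂ * (b₂ + 1) + t₂ - b₂) (b₂ + 1) =
      (q₂ + 1) * hubCount (q₂ * (b₂ + 1) + t₂) b₂ := by
    rw [u₂]
    rcases q₂ with _ | q₂
    · obtain rfl : t₂ = b₂ := by omega
      simp
    · rw [show (q₂ + 1) * (b₂ + 1) + t₂ - b₂ = q₂ * (b₂ + 1) + (t₂ + 1) by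
        rw [show (q₂ + 1) * (b₂ + 1) + t₂ = q₂ * (b₂ + 1) + (t₂ + 1) + b₂ by ring]; omega,
        turanCount_eq _ _ _ (by omega), show b₂ + 1 - (t₂ + 1) = b₂ - t₂ by omega]
      ring
  have p₁ : hubCount (q₁ * (b₁ + 1) + t₁) b₁ ≤ P₁ := by
    rw [u₁]; exact Nat.mul_le_mul (Nat.pow_le_pow_left (by omega) _)
      (Nat.pow_le_pow_left (by omega) _)
  have p₂ : hubCount (q₂ * (b₂ + 1) + t₂) b₂ ≤ P₂ := by
    rw [u₂]; exact Nat.mul_le_mul (Nat.pow_le_pow_left (by omega) _)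
      (Nat.pow_le_pow_left (by omega) _)
  have strict : ∀ q b t : ℕ, t ≤ b → 1 ≤ b →
      q ^ (b - t) * (q + 1) ^ t < (q + 1) ^ (b - t) * (q + 2) ^ t := by
    intro q b t ht hb
    rcases Nat.eq_zero_or_pos t with rfl | h0
    · simpa using Nat.pow_lt_pow_left (Nat.lt_succ_self q) (by omega)
    · exact Nat.mul_lt_mul_of_le_of_lt (Nat.pow_le_pow_left (by omega) _)
        (Nat.pow_lt_pow_left (by omega) (by omega)) (by positivity)
  have w₁ : 0 < P₁ := by positivity
  -- Rehanging the second family on the first hub gains exactly this product of two differences;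
  -- `hA` and `hB` then rebalance. The first factor vanishes only for b₂ = 0, the second only for b₁
  -- = 0 and q₁ = q₂.
  have key : turanCount (q₁ * (b₁ + 1) + t₁) (b₁ + 1) *
        turanConnectedCount (q₂ * (b₂ + 1) + t₂) b₂ +
      hubCount (q₁ * (b₁ + 1) + t₁) b₁ * turanCount (q₂ * (b₂ + 1) + t₂) (b₂ + 1) +
      (P₂ - hubCount (q₂ * (b₂ + 1) + t₂) b₂) *
        ((q₁ + 1) * P₁ - (q₂ + 1) * hubCount (q₁ * (b₁ + 1) + t₁) b₁) ≤
      turanConnectedCount (q₁ * (b₁ + 1) + t₁ + (q₂ * (b₂ + 1) + t₂) + 1) (b₁ + b₂ + 1) := by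
    unfold turanConnectedCount
    refine le_trans (le_of_eq ?_) (add_le_add hA hB)
    rw [a₁, a₂, c₂, v₂]
    obtain ⟨x, hx⟩ := Nat.exists_eq_add_of_le p₂
    obtain ⟨y, hy⟩ := Nat.exists_eq_add_of_le
      (Nat.mul_le_mul (Nat.add_le_add_right hk 1) p₁)
    rw [hy, Nat.add_sub_cancel_left]
    nth_rewrite 3 [hx]
    rw [Nat.add_sub_cancel_left, hx]
    ring
  refine ⟨le_trans (Nat.le_add_right _ _) key, fun heq => ?_⟩
  by_contra! hcon
  have x1 : 0 < P₂ - hubCount (q₂ * (b₂ + 1) + t₂) b₂ := by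
    rw [u₂]
    exact Nat.sub_pos_of_lt (strict _ _ _ ht₂ (by omega))
  have x2 : 0 < (q₁ + 1) * P₁ - (q₂ + 1) * hubCount (q₁ * (b₁ + 1) + t₁) b₁ := by
    apply Nat.sub_pos_of_lt
    rcases Nat.eq_zero_or_pos b₁ with h0 | h0
    · have : q₂ < q₁ := lt_of_le_of_ne hk (Ne.symm (hcon.2 h0))
      calc _ ≤ (q₂ + 1) * P₁ := Nat.mul_le_mul_left _ p₁
        _ < _ := Nat.mul_lt_mul_of_pos_right (by omega) w₁
    · calc _ < (q₂ + 1) * P₁ := Nat.mul_lt_mul_of_pos_left (by rw [u₁]; exact strict _ _ _ ht₁ h0)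
            (by omega)
        _ ≤ _ := Nat.mul_le_mul_right _ (by omega)
  have := Nat.mul_pos x1 x2
  omega

/-! ### Counting stable sets inside a vertex set, and the Turán-type bound -/

section StableSets

variable {V : Type*} {G : SimpleGraph V} {W : Finset V}

open Classical in
/-- The stable sets of `G` contained in `W`. -/
noncomputable def stableSets (G : SimpleGraph V) (W : Finset V) : Finset (Finset V) :=
  W.powerset.filter fun s => G.IsIndepSet (s : Set V)

/-- The number of stable sets of `G` contained in `W`. -/
noncomputable def stableCount (G : SimpleGraph V) (W : Finset V) : ℕ := (stableSets G W).card

/-- The largest size of a stable set of `G` contained in `W`. -/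
noncomputable def stabilityOn (G : SimpleGraph V) (W : Finset V) : ℕ :=
  (stableSets G W).sup Finset.card

open Classical in
/-- The vertices of `W` that are neither equal nor adjacent to `v`. -/
noncomputable def awayFrom (G : SimpleGraph V) (W : Finset V) (v : V) : Finset V :=
  W.filter fun w => w ≠ v ∧ ¬G.Adj v w

open Classical in
/-- The neighbours of `v` in `W`. -/
noncomputable def neighborsIn (G : SimpleGraph V) (W : Finset V) (v : V) : Finset V :=
  W.filter fun w => G.Adj v w

theorem mem_stableSets {s : Finset V} :
    s ∈ stableSets G W ↔ s ⊆ W ∧ ∀ a ∈ s, ∀ b ∈ s, ¬G.Adj a b := by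
  classical
  simp only [stableSets, Finset.mem_filter, Finset.mem_powerset, SimpleGraph.IsIndepSet]
  refine and_congr_right fun _ => ⟨fun h a ha b hb hab => h ha hb hab.ne hab,
    fun h a ha b hb _ => h a ha b hb⟩

theorem mem_awayFrom {v w : V} : w ∈ awayFrom G W v ↔ w ∈ W ∧ w ≠ v ∧ ¬G.Adj v w := by
  classical simp [awayFrom]

theorem mem_neighborsIn {v w : V} : w ∈ neighborsIn G W v ↔ w ∈ W ∧ G.Adj v w := by
  classical simp [neighborsIn]

theorem awayFrom_subset (v : V) : awayFrom G W v ⊆ W := fun _ h => (mem_awayFrom.1 h).1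

theorem neighborsIn_subset (v : V) : neighborsIn G W v ⊆ W := fun _ h => (mem_neighborsIn.1 h).1

theorem card_awayFrom {v : V} (hv : v ∈ W) :
    (awayFrom G W v).card + (neighborsIn G W v).card + 1 = W.card := by
  classical
  rw [← Finset.card_erase_add_one hv, ← Finset.card_union_of_disjoint]
  · congr 2
    ext w
    simp only [Finset.mem_union, mem_awayFrom, mem_neighborsIn, Finset.mem_erase]
    have : G.Adj v w → w ≠ v := fun h => h.ne'
    tauto
  · rw [Finset.disjoint_left]
    intro w h h'
    exact (mem_awayFrom.1 h).2.2 (mem_neighborsIn.1 h').2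

theorem stableSets_mono {U : Finset V} (h : U ⊆ W) : stableSets G U ⊆ stableSets G W := by
  intro s hs
  rw [mem_stableSets] at hs ⊢
  exact ⟨hs.1.trans h, hs.2⟩

theorem stableCount_mono {U : Finset V} (h : U ⊆ W) : stableCount G U ≤ stableCount G W :=
  Finset.card_le_card (stableSets_mono h)

theorem stableCount_pos : 0 < stableCount G W :=
  Finset.card_pos.2 ⟨∅, mem_stableSets.2 ⟨Finset.empty_subset _, by simp⟩⟩

/-- Singletons are stable, so a vertex set can be read off from its family of stable sets. -/
theorem eq_of_stableCount_eq {U : Finset V} (h : U ⊆ W)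
    (hc : stableCount G U = stableCount G W) : U = W := by
  have := Finset.eq_of_subset_of_card_le (stableSets_mono (G := G) h) hc.ge
  refine h.antisymm fun w hw => ?_
  have hs : {w} ∈ stableSets G W := mem_stableSets.2 ⟨by simpa, by simp⟩
  rw [← this] at hs
  simpa using (mem_stableSets.1 hs).1

theorem stableCount_empty : stableCount G ∅ = 1 := by
  rw [stableCount, Finset.card_eq_one]
  refine ⟨∅, ?_⟩
  ext s
  rw [mem_stableSets, Finset.mem_singleton, Finset.subset_empty]
  constructor
  · exact And.left
  · rintro rfl; simp

theorem stableCount_lt_of_le {H : SimpleGraph V} (hle : H ≤ G) {a b : V} (ha : a ∈ W) (hb : b ∈ W)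
    (hab : G.Adj a b) (hab' : ¬H.Adj a b) : stableCount G W < stableCount H W := by
  classical
  refine Finset.card_lt_card ⟨fun s hs => ?_, fun hsub => ?_⟩
  · rw [mem_stableSets] at hs ⊢
    exact ⟨hs.1, fun x hx y hy h => hs.2 x hx y hy (hle h)⟩
  · have : {a, b} ∈ stableSets H W := by
      rw [mem_stableSets]
      refine ⟨by simp [Finset.insert_subset_iff, ha, hb], ?_⟩
      simp [hab', H.adj_comm b a]
    exact (mem_stableSets.1 (hsub this)).2 a (by simp) b (by simp) hab

open Classical in
-- Stable sets are split according to whether they contain v; those that do are v together with a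
-- stable set of its non-neighbours.
theorem stableCount_eq_erase_add {v : V} (hv : v ∈ W) :
    stableCount G W = stableCount G (W.erase v) + stableCount G (awayFrom G W v) := by
  unfold stableCount
  rw [← Finset.card_filter_add_card_filter_not (s := stableSets G W) (fun s => v ∉ s)]
  congr 1
  · congr 1
    ext s
    simp only [Finset.mem_filter, mem_stableSets, Finset.subset_erase]
    tauto
  · refine Finset.card_bij' (fun s _ => s.erase v) (fun s _ => insert v s) ?_ ?_ ?_ ?_
    · intro s hs
      simp only [Finset.mem_filter, mem_stableSets, not_not] at hs
      obtain ⟨⟨h1, h2⟩, h3⟩ := hs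
      rw [mem_stableSets]
      refine ⟨fun w hw => ?_, fun a ha b hb =>
        h2 a (Finset.mem_of_mem_erase ha) b (Finset.mem_of_mem_erase hb)⟩
      rw [Finset.mem_erase] at hw
      exact mem_awayFrom.2 ⟨h1 hw.2, hw.1, h2 v h3 w hw.2⟩
    · intro s hs
      rw [mem_stableSets] at hs
      simp only [Finset.mem_filter, mem_stableSets, not_not]
      refine ⟨⟨Finset.insert_subset hv (hs.1.trans (awayFrom_subset v)), ?_⟩,
        Finset.mem_insert_self _ _⟩
      intro a ha b hb hab
      rw [Finset.mem_insert] at ha hb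
      rcases ha with rfl | ha <;> rcases hb with rfl | hb
      · exact hab.ne rfl
      · exact (mem_awayFrom.1 (hs.1 hb)).2.2 hab
      · exact (mem_awayFrom.1 (hs.1 ha)).2.2 hab.symm
      · exact hs.2 a ha b hb hab
    · intro s hs
      simp only [Finset.mem_filter, not_not] at hs
      exact Finset.insert_erase hs.2
    · intro s hs
      rw [mem_stableSets] at hs
      exact Finset.erase_insert fun h => (mem_awayFrom.1 (hs.1 h)).2.1 rfl

open Classical in
theorem stableCount_union {A B : Finset V} (hd : Disjoint A B)
    (h : ∀ a ∈ A, ∀ b ∈ B, ¬G.Adj a b) :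
    stableCount G (A ∪ B) = stableCount G A * stableCount G B := by
  unfold stableCount
  rw [← Finset.card_product]
  rw [Finset.disjoint_left] at hd
  refine Finset.card_bij' (fun s _ => (s ∩ A, s ∩ B)) (fun p _ => p.1 ∪ p.2) ?_ ?_ ?_ ?_
  · intro s hs
    rw [mem_stableSets] at hs
    rw [Finset.mem_product, mem_stableSets, mem_stableSets]
    simp only [Finset.mem_inter]
    exact ⟨⟨Finset.inter_subset_right, fun a ha b hb => hs.2 a ha.1 b hb.1⟩,
      Finset.inter_subset_right, fun a ha b hb => hs.2 a ha.1 b hb.1⟩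
  · intro p hp
    rw [Finset.mem_product, mem_stableSets, mem_stableSets] at hp
    obtain ⟨⟨h1, h2⟩, h3, h4⟩ := hp
    rw [mem_stableSets]
    refine ⟨Finset.union_subset_union h1 h3, ?_⟩
    intro a ha b hb hab
    rw [Finset.mem_union] at ha hb
    rcases ha with ha | ha <;> rcases hb with hb | hb
    · exact h2 a ha b hb hab
    · exact h a (h1 ha) b (h3 hb) hab
    · exact h b (h1 hb) a (h3 ha) hab.symm
    · exact h4 a ha b hb hab
  · intro s hs
    rw [mem_stableSets] at hs
    simp only
    rw [← Finset.inter_union_distrib_left, Finset.inter_eq_left.2 hs.1]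
  · rintro ⟨s, t⟩ hp
    rw [Finset.mem_product, mem_stableSets, mem_stableSets] at hp
    obtain ⟨⟨h1, -⟩, h3, -⟩ := hp
    simp only at h1 h3 ⊢
    ext x <;> simp only [Finset.mem_inter, Finset.mem_union] <;>
      have := @h1 x <;> have := @h3 x <;> have := @hd x <;> tauto

theorem stableCount_clique (h : ∀ a ∈ W, ∀ b ∈ W, a ≠ b → G.Adj a b) :
    stableCount G W = W.card + 1 := by
  classical
  induction W using Finset.induction_on with
  | empty => simp [stableCount_empty]
  | insert v W hv ih =>
    rw [stableCount_eq_erase_add (Finset.mem_insert_self v W), Finset.erase_insert hv,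
      ih fun a ha b hb => h a (Finset.mem_insert_of_mem ha) b (Finset.mem_insert_of_mem hb),
      Finset.card_insert_of_notMem hv]
    congr 1
    rw [show awayFrom G (insert v W) v = ∅ from ?_, stableCount_empty]
    rw [Finset.eq_empty_iff_forall_notMem]
    intro w hw
    rw [mem_awayFrom] at hw
    exact hw.2.2 (h v (Finset.mem_insert_self _ _) w hw.1 hw.2.1.symm)

open Classical in
/-- The number of stable sets of a disjoint union of cliques. -/
theorem stableCount_cliques {ι : Type*} (c : V → ι) (J : Finset ι) (hJ : ∀ w ∈ W, c w ∈ J)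
    (h : ∀ a ∈ W, ∀ b ∈ W, a ≠ b → (G.Adj a b ↔ c a = c b)) :
    stableCount G W = ∏ j ∈ J, ((W.filter fun w => c w = j).card + 1) := by
  induction J using Finset.induction_on generalizing W with
  | empty =>
    rw [Finset.eq_empty_of_forall_notMem fun w hw => absurd (hJ w hw) (by simp)]
    simp [stableCount_empty]
  | insert i J hi ih =>
    rw [Finset.prod_insert hi, ← Finset.filter_union_filter_not_eq (fun w => c w = i) W,
      stableCount_union (Finset.disjoint_filter_filter_not _ _ _),
      Finset.filter_union_filter_not_eq]
    · congr 1
      · apply stableCount_clique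
        intro a ha b hb hab
        rw [Finset.mem_filter] at ha hb
        exact (h a ha.1 b hb.1 hab).2 (ha.2.trans hb.2.symm)
      · rw [ih]
        · refine Finset.prod_congr rfl fun j hj => ?_
          rw [Finset.filter_filter]
          congr 3
          ext w
          refine ⟨And.right, fun h => ⟨?_, h⟩⟩
          rintro h'
          exact hi (h' ▸ h ▸ hj)
        · intro w hw
          rw [Finset.mem_filter] at hw
          exact (Finset.mem_insert.1 (hJ w hw.1)).resolve_left hw.2
        · intro a ha b hb
          exact h a (Finset.mem_filter.1 ha).1 b (Finset.mem_filter.1 hb).1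
    · intro a ha b hb hab
      rw [Finset.mem_filter] at ha hb
      exact hb.2 (((h a ha.1 b hb.1 hab.ne).1 hab).symm.trans ha.2)

theorem card_le_stabilityOn {s : Finset V} (hs : s ∈ stableSets G W) : s.card ≤ stabilityOn G W :=
  Finset.le_sup (f := Finset.card) hs

theorem exists_card_eq_stabilityOn (G : SimpleGraph V) (W : Finset V) :
    ∃ s ∈ stableSets G W, s.card = stabilityOn G W := by
  obtain ⟨s, hs, h⟩ := Finset.exists_mem_eq_sup (stableSets G W)
    (Finset.card_pos.1 stableCount_pos) Finset.card
  exact ⟨s, hs, h.symm⟩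

theorem stabilityOn_le {k : ℕ} (h : ∀ s ∈ stableSets G W, s.card ≤ k) : stabilityOn G W ≤ k :=
  Finset.sup_le h

theorem stabilityOn_mono {U : Finset V} (h : U ⊆ W) : stabilityOn G U ≤ stabilityOn G W :=
  Finset.sup_mono (stableSets_mono h)

theorem stabilityOn_anti {H : SimpleGraph V} (hle : H ≤ G) : stabilityOn G W ≤ stabilityOn H W := by
  refine Finset.sup_mono fun s hs => ?_
  rw [mem_stableSets] at hs ⊢
  exact ⟨hs.1, fun x hx y hy h => hs.2 x hx y hy (hle h)⟩

theorem stabilityOn_pos (h : W.Nonempty) : 0 < stabilityOn G W := by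
  obtain ⟨w, hw⟩ := h
  have hs : {w} ∈ stableSets G W := mem_stableSets.2 ⟨by simpa, by simp⟩
  exact (Finset.card_singleton w).symm.le.trans (card_le_stabilityOn hs)

theorem stabilityOn_le_card : stabilityOn G W ≤ W.card :=
  stabilityOn_le fun _ hs => Finset.card_le_card (mem_stableSets.1 hs).1

theorem stabilityOn_awayFrom_lt {v : V} (hv : v ∈ W) :
    stabilityOn G (awayFrom G W v) < stabilityOn G W := by
  classical
  obtain ⟨s, hs, h⟩ := exists_card_eq_stabilityOn G (awayFrom G W v)
  rw [mem_stableSets] at hs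
  have hvs : v ∉ s := fun h => (mem_awayFrom.1 (hs.1 h)).2.1 rfl
  rw [← h, ← Nat.succ_le_iff, Nat.succ_eq_add_one, ← Finset.card_insert_of_notMem hvs]
  apply card_le_stabilityOn
  rw [mem_stableSets]
  refine ⟨Finset.insert_subset hv (hs.1.trans (awayFrom_subset v)), ?_⟩
  intro a ha b hb hab
  rw [Finset.mem_insert] at ha hb
  rcases ha with rfl | ha <;> rcases hb with rfl | hb
  · exact hab.ne rfl
  · exact (mem_awayFrom.1 (hs.1 hb)).2.2 hab
  · exact (mem_awayFrom.1 (hs.1 ha)).2.2 hab.symm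
  · exact hs.2 a ha b hb hab

theorem stabilityOn_union [DecidableEq V] {A B : Finset V} (hd : Disjoint A B)
    (h : ∀ a ∈ A, ∀ b ∈ B, ¬G.Adj a b) :
    stabilityOn G A + stabilityOn G B ≤ stabilityOn G (A ∪ B) := by
  obtain ⟨s, hs, hsc⟩ := exists_card_eq_stabilityOn G A
  obtain ⟨t, ht, htc⟩ := exists_card_eq_stabilityOn G B
  rw [mem_stableSets] at hs ht
  rw [← hsc, ← htc, ← Finset.card_union_of_disjoint (hd.mono hs.1 ht.1)]
  apply card_le_stabilityOn
  rw [mem_stableSets]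
  refine ⟨Finset.union_subset_union hs.1 ht.1, ?_⟩
  intro a ha b hb hab
  rw [Finset.mem_union] at ha hb
  rcases ha with ha | ha <;> rcases hb with hb | hb
  · exact hs.2 a ha b hb hab
  · exact h a (hs.1 ha) b (ht.1 hb) hab
  · exact h b (hs.1 hb) a (ht.1 ha) hab.symm
  · exact ht.2 a ha b hb hab

theorem stabilityOn_union_le [DecidableEq V] (A B : Finset V) :
    stabilityOn G (A ∪ B) ≤ stabilityOn G A + stabilityOn G B := by
  obtain ⟨s, hs, hsc⟩ := exists_card_eq_stabilityOn G (A ∪ B)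
  rw [mem_stableSets] at hs
  have h1 : s ∩ A ∈ stableSets G A := mem_stableSets.2 ⟨Finset.inter_subset_right,
    fun a ha b hb => hs.2 a (Finset.mem_inter.1 ha).1 b (Finset.mem_inter.1 hb).1⟩
  have h2 : s ∩ B ∈ stableSets G B := mem_stableSets.2 ⟨Finset.inter_subset_right,
    fun a ha b hb => hs.2 a (Finset.mem_inter.1 ha).1 b (Finset.mem_inter.1 hb).1⟩
  rw [← hsc, ← Finset.inter_eq_left.2 hs.1, Finset.inter_union_distrib_left]
  exact (Finset.card_union_le _ _).trans
    (add_le_add (card_le_stabilityOn h1) (card_le_stabilityOn h2))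

/-- A greedy bound for the stability number of a graph all of whose subgraphs have a vertex of
degree less than `d`. -/
theorem card_le_mul_stabilityOn {d : ℕ}
    (h : ∀ A ⊆ W, A.Nonempty → ∃ a ∈ A, (neighborsIn G A a).card < d) :
    W.card ≤ d * stabilityOn G W := by
  induction hn : W.card using Nat.strong_induction_on generalizing W with
  | _ n ih =>
  subst hn
  rcases W.eq_empty_or_nonempty with rfl | hW
  · simp
  obtain ⟨a, ha, hd⟩ := h W subset_rfl hW
  have h1 := card_awayFrom (G := G) ha
  have h2 := ih (awayFrom G W a).card (by omega) (fun A hA => h A (hA.trans (awayFrom_subset a))) rfl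
  have h3 := Nat.mul_le_mul_left d (Nat.succ_le_of_lt (stabilityOn_awayFrom_lt (G := G) ha))
  rw [Nat.succ_eq_add_one, mul_add] at h3
  omega

theorem neighborsIn_mono {U : Finset V} (h : U ⊆ W) (v : V) :
    neighborsIn G U v ⊆ neighborsIn G W v := fun w hw => by
  rw [mem_neighborsIn] at hw ⊢
  exact ⟨h hw.1, hw.2⟩

/-- If all degrees were below q = `m / (b + 1)`, the greedy bound would give m + 1 ≤ q(b + 1) ≤ m.
-/
theorem exists_le_card_neighborsIn {m b : ℕ} (hm : W.card = m + 1) (hb : stabilityOn G W ≤ b + 1) :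
    ∃ v ∈ W, m / (b + 1) ≤ (neighborsIn G W v).card := by
  by_contra! hcon
  have h1 := card_le_mul_stabilityOn (G := G) (W := W) (d := m / (b + 1)) fun A hA ⟨a, ha⟩ =>
    ⟨a, ha, (Finset.card_le_card (neighborsIn_mono hA a)).trans_lt (hcon a (hA ha))⟩
  have h2 := Nat.mul_le_mul_left (m / (b + 1)) hb
  have h3 := Nat.div_mul_le_self m (b + 1)
  omega

/-- Among the graphs with bounded stability number, the disjoint unions of balanced cliques have
the most stable sets. -/
theorem stableCount_le_turanCount {a : ℕ} (h : stabilityOn G W ≤ a) :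
    stableCount G W ≤ turanCount W.card a := by
  classical
  induction hn : W.card using Nat.strong_induction_on generalizing W a with
  | _ n ih =>
  subst hn
  rcases W.eq_empty_or_nonempty with rfl | hW
  · simp [stableCount_empty]
  obtain ⟨m, hm⟩ := Nat.exists_eq_add_of_le' hW.card_pos
  obtain ⟨b, rfl⟩ := Nat.exists_eq_add_of_le' ((stabilityOn_pos (G := G) hW).trans_le h)
  obtain ⟨v, hv, hd⟩ := exists_le_card_neighborsIn (by omega) h
  have h1 := card_awayFrom (G := G) hv
  have h2 := Finset.card_erase_of_mem hv
  have h3 := stabilityOn_awayFrom_lt (G := G) hv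
  have h4 := ih _ (by omega) ((stabilityOn_mono (W.erase_subset v)).trans h) rfl
  have h5 := ih (awayFrom G W v).card (by omega) (a := b) (by omega) rfl
  rw [stableCount_eq_erase_add hv, hm, turanCount_succ]
  refine add_le_add ?_ (h5.trans (turanCount_mono _ ?_))
  · rwa [show (W.erase v).card = m by omega] at h4
  · generalize m / (b + 1) = x at *
    omega

end StableSets

/-! ### Uniqueness in the Turán-type bound -/

section Coloring

variable {V : Type*} {G : SimpleGraph V} {W : Finset V}

/-- The subgraph induced by `W` is a disjoint union of cliques, the classes of the coloring `c`. -/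
structure IsCliqueColoring {ι : Type*} (G : SimpleGraph V) (W : Finset V) (c : V → ι)
    (J : Finset ι) : Prop where
  mem : ∀ w ∈ W, c w ∈ J
  adj_iff : ∀ x ∈ W, ∀ y ∈ W, x ≠ y → (G.Adj x y ↔ c x = c y)

namespace IsCliqueColoring

variable {ι : Type*} {c : V → ι} {J : Finset ι}

theorem stabilityOn_le_card (h : IsCliqueColoring G W c J) : stabilityOn G W ≤ J.card := by
  refine stabilityOn_le fun s hs => ?_
  rw [mem_stableSets] at hs
  refine Finset.card_le_card_of_injOn c (fun w hw => h.mem w (hs.1 hw)) ?_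
  intro x hx y hy hxy
  by_contra hne
  exact hs.2 x hx y hy ((h.adj_iff x (hs.1 hx) y (hs.1 hy) hne).2 hxy)

theorem sum_card [DecidableEq ι] (h : IsCliqueColoring G W c J) :
    ∑ j ∈ J, (W.filter fun w => c w = j).card = W.card :=
  (Finset.card_eq_sum_card_fiberwise h.mem).symm

theorem stableCount_eq [DecidableEq ι] (h : IsCliqueColoring G W c J) :
    stableCount G W = ∏ j ∈ J, ((W.filter fun w => c w = j).card + 1) := by
  convert stableCount_cliques c J h.mem h.adj_iff

theorem balanced [DecidableEq ι] (h : IsCliqueColoring G W c J)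
    (hc : stableCount G W = turanCount W.card J.card)
    {i j : ι} (hi : i ∈ J) (hj : j ∈ J) :
    (W.filter fun w => c w = i).card ≤ (W.filter fun w => c w = j).card + 1 := by
  rw [h.stableCount_eq, ← h.sum_card] at hc
  exact le_succ_of_prod_succ_eq (s := fun j => (W.filter fun w => c w = j).card) hc hi hj

theorem mono {U : Finset V} (h : IsCliqueColoring G W c J) (hU : U ⊆ W) :
    IsCliqueColoring G U c J :=
  ⟨fun w hw => h.mem w (hU hw), fun x hx y hy => h.adj_iff x (hU hx) y (hU hy)⟩

theorem erase [DecidableEq ι] (h : IsCliqueColoring G W c J) (i : ι) :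
    IsCliqueColoring G (W.filter fun w => c w ≠ i) c (J.erase i) :=
  ⟨fun w hw => Finset.mem_erase.2 ⟨(Finset.mem_filter.1 hw).2, h.mem w (Finset.mem_filter.1 hw).1⟩,
    (h.mono (Finset.filter_subset _ _)).adj_iff⟩

end IsCliqueColoring

/-- The sum is at most s i + b(s i + 1), which is less than (b + 1)(s i + 1). -/
theorem div_le_of_balanced {ι : Type*} {J : Finset ι} {s : ι → ℕ} {m b : ℕ}
    (hs : ∑ j ∈ J, s j = m) (hJ : J.card = b + 1) {i : ι} (hi : i ∈ J)
    (h : ∀ j ∈ J, s j ≤ s i + 1) : m / (b + 1) ≤ s i := by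
  classical
  rw [← Nat.lt_succ_iff, Nat.div_lt_iff_lt_mul (by omega), ← hs, ← Finset.add_sum_erase J _ hi]
  have h1 := Finset.sum_le_card_nsmul (J.erase i) s (s i + 1) fun j hj =>
    h j (Finset.mem_of_mem_erase hj)
  rw [Finset.card_erase_of_mem hi, hJ, smul_eq_mul, Nat.add_sub_cancel] at h1
  rw [Nat.succ_eq_add_one]
  nlinarith

theorem le_div_succ_of_balanced {ι : Type*} {J : Finset ι} {s : ι → ℕ} {m b : ℕ}
    (hs : ∑ j ∈ J, s j = m) (hJ : J.card = b + 1) {i : ι} (h : ∀ j ∈ J, s i ≤ s j + 1) :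
    s i ≤ m / (b + 1) + 1 := by
  rcases Nat.eq_zero_or_pos (s i) with h0 | h0
  · rw [h0]; exact Nat.zero_le _
  obtain ⟨k, hk⟩ := Nat.exists_eq_add_of_le' h0
  have h1 := Finset.card_nsmul_le_sum J s k fun j hj => by have := h j hj; omega
  rw [hJ, smul_eq_mul, hs] at h1
  have := (Nat.le_div_iff_mul_le (Nat.succ_pos b)).2 (mul_comm (b + 1) k ▸ h1)
  rw [hk]
  exact Nat.succ_le_succ this

theorem eq_of_balanced {ι : Type*} {J : Finset ι} {s : ι → ℕ} {q : ℕ}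
    (hs : ∑ j ∈ J, s j = q * J.card) (h : ∀ i ∈ J, ∀ j ∈ J, s i ≤ s j + 1) {i : ι} (hi : i ∈ J) :
    s i = q := by
  obtain ⟨b, hb⟩ := Nat.exists_eq_add_of_le' (Finset.card_pos.2 ⟨i, hi⟩)
  have h1 : ∀ i ∈ J, q ≤ s i := fun i hi => by
    have := div_le_of_balanced hs hb hi fun j hj => h j hj i hi
    rwa [hb, Nat.mul_div_cancel _ (by omega)] at this
  have h2 : ∑ j ∈ J, q = ∑ j ∈ J, s j := by rw [hs]; simp [mul_comm]
  exact (((Finset.sum_eq_sum_iff_of_le h1).1 h2) i hi).symm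

/-- A vertex outside a disjoint union of `a` cliques is adjacent to all vertices of one of them if
the stability number is at most `a`. -/
theorem exists_adj_class [DecidableEq V] {c : V → ℕ} {a : ℕ} {v : V} (hv : v ∈ W)
    (hW : stabilityOn G W ≤ a) (h : IsCliqueColoring G (W.erase v) c (Finset.range a)) :
    ∃ i ∈ Finset.range a, ∀ w ∈ W.erase v, c w = i → G.Adj v w := by
  by_contra! hcon
  have : Nonempty V := ⟨v⟩
  choose! r hr1 hr2 hr3 using hcon
  have hinj : Set.InjOn r (Finset.range a : Set ℕ) := fun i hi j hj hij => by
    rw [← hr2 i hi, ← hr2 j hj, hij]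
  have hvr : v ∉ (Finset.range a).image r := by
    intro hmem
    obtain ⟨i, hi, rfl⟩ := Finset.mem_image.1 hmem
    exact (Finset.mem_erase.1 (hr1 i hi)).1 rfl
  -- One non-neighbour of v from each class, together with v, would be a stable set of size a + 1.
  have hs : insert v ((Finset.range a).image r) ∈ stableSets G W := by
    rw [mem_stableSets]
    refine ⟨Finset.insert_subset hv (Finset.image_subset_iff.2 fun i hi =>
      Finset.mem_of_mem_erase (hr1 i hi)), ?_⟩
    intro x hx y hy hxy
    rw [Finset.mem_insert, Finset.mem_image] at hx hy
    rcases hx with rfl | ⟨i, hi, rfl⟩ <;> rcases hy with rfl | ⟨j, hj, rfl⟩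
    · exact hxy.ne rfl
    · exact hr3 j hj hxy
    · exact hr3 i hi hxy.symm
    · have := (h.adj_iff _ (hr1 i hi) _ (hr1 j hj) hxy.ne).1 hxy
      rw [hr2 i hi, hr2 j hj] at this
      exact hxy.ne (by rw [this])
  have := card_le_stabilityOn hs
  rw [Finset.card_insert_of_notMem hvr, Finset.card_image_of_injOn hinj, Finset.card_range] at this
  omega

/-- The extremal graphs for `stableCount_le_turanCount` are disjoint unions of cliques. -/
theorem exists_isCliqueColoring {a : ℕ} (h : stabilityOn G W ≤ a)
    (heq : stableCount G W = turanCount W.card a) :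
    ∃ c, IsCliqueColoring G W c (Finset.range a) := by
  classical
  induction hn : W.card using Nat.strong_induction_on generalizing W a with
  | _ n ih =>
  subst hn
  rcases W.eq_empty_or_nonempty with rfl | hW
  · exact ⟨fun _ => 0, by simp, by simp⟩
  obtain ⟨m, hm⟩ := Nat.exists_eq_add_of_le' hW.card_pos
  obtain ⟨b, rfl⟩ := Nat.exists_eq_add_of_le' ((stabilityOn_pos (G := G) hW).trans_le h)
  obtain ⟨v, hv, hd⟩ := exists_le_card_neighborsIn (by omega) h
  have h1 := card_awayFrom (G := G) hv
  have h2 : (W.erase v).card = m := by rw [Finset.card_erase_of_mem hv]; omega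
  have h3 := stabilityOn_awayFrom_lt (G := G) hv
  have hstab : stabilityOn G (W.erase v) ≤ b + 1 := (stabilityOn_mono (W.erase_subset v)).trans h
  have h4 := stableCount_le_turanCount hstab
  have h5 := stableCount_le_turanCount (G := G) (W := awayFrom G W v) (a := b) (by omega)
  have h6 : turanCount (awayFrom G W v).card b ≤ turanCount (m - m / (b + 1)) b := by
    apply turanCount_mono
    generalize m / (b + 1) = x at *
    omega
  rw [stableCount_eq_erase_add hv, hm, turanCount_succ] at heq
  rw [h2] at h4
  -- Equality in the sum forces equality in both summands, so W without v is extremal and the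
  -- induction hypothesis colours it.
  obtain ⟨c, hc⟩ := ih _ (by omega) hstab (by rw [h2]; omega) rfl
  obtain ⟨i, hi, hadj⟩ := exists_adj_class hv h hc
  set X := (W.erase v).filter fun w => c w ≠ i with hX
  have hsub : awayFrom G W v ⊆ X := by
    intro w hw
    rw [mem_awayFrom] at hw
    rw [hX, Finset.mem_filter, Finset.mem_erase]
    exact ⟨⟨hw.2.1, hw.1⟩, fun hcw => hw.2.2 (hadj w (Finset.mem_erase.2 ⟨hw.2.1, hw.1⟩) hcw)⟩
  have hXstab : stabilityOn G X ≤ b := by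
    refine ((hc.erase i).stabilityOn_le_card).trans ?_
    rw [Finset.card_erase_of_mem hi, Finset.card_range]; omega
  have hclass : m / (b + 1) ≤ ((W.erase v).filter fun w => c w = i).card :=
    div_le_of_balanced (s := fun i => ((W.erase v).filter fun w => c w = i).card)
      (hc.sum_card.trans h2) (by simp) hi fun j hj =>
        hc.balanced (by rw [h2, Finset.card_range]; omega) hj hi
  have hXcard := Finset.card_filter_add_card_filter_not (s := W.erase v) (fun w => c w = i)
  have hX' : stableCount G X ≤ turanCount (m - m / (b + 1)) b := by
    refine (stableCount_le_turanCount hXstab).trans (turanCount_mono _ ?_)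
    change _ + X.card = _ at hXcard
    generalize m / (b + 1) = x at *
    omega
  -- The non-neighbours of v lie in the union X of the classes other than i, and their count already
  -- reaches the upper bound for X. Hence they fill X, and v is adjacent to class i and to nothing
  -- else.
  have hXeq : awayFrom G W v = X :=
    eq_of_stableCount_eq (G := G) hsub (le_antisymm (stableCount_mono hsub) (by omega))
  have hnadj : ∀ w ∈ W.erase v, (G.Adj v w ↔ c w = i) := by
    intro w hw
    refine ⟨fun hvw => ?_, hadj w hw⟩
    by_contra hne
    have : w ∈ awayFrom G W v := by
      rw [hXeq, hX, Finset.mem_filter]; exact ⟨hw, hne⟩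
    exact (mem_awayFrom.1 this).2.2 hvw
  refine ⟨Function.update c v i, fun w hw => ?_, fun x hx y hy hxy => ?_⟩
  · rcases eq_or_ne w v with rfl | hne
    · simpa using hi
    · rw [Function.update_of_ne hne]
      exact hc.mem w (Finset.mem_erase.2 ⟨hne, hw⟩)
  · rcases eq_or_ne x v with rfl | hxv
    · rw [Function.update_self, Function.update_of_ne hxy.symm,
        hnadj y (Finset.mem_erase.2 ⟨hxy.symm, hy⟩), eq_comm]
    · rcases eq_or_ne y v with rfl | hyv
      · rw [Function.update_self, Function.update_of_ne hxv, G.adj_comm,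
          hnadj x (Finset.mem_erase.2 ⟨hxv, hx⟩)]
      · rw [Function.update_of_ne hxv, Function.update_of_ne hyv]
        exact hc.adj_iff x (Finset.mem_erase.2 ⟨hxv, hx⟩) y (Finset.mem_erase.2 ⟨hyv, hy⟩) hxy

end Coloring

/-! ### Connectivity, edge-criticality and bridges -/

section Connected

variable {V : Type*} {G : SimpleGraph V} {W : Finset V}

/-- The subgraph induced by `W` is connected: every proper nonempty part of `W` is left by an
edge. -/
def IsConnectedOn (G : SimpleGraph V) (W : Finset V) : Prop :=
  W.Nonempty ∧ ∀ A ⊆ W, A.Nonempty → A ≠ W → ∃ a ∈ A, ∃ b ∈ W, b ∉ A ∧ G.Adj a b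

/-- The deletion of any edge inside `W` increases the stability number. -/
def IsStabilityCriticalOn (G : SimpleGraph V) (W : Finset V) : Prop :=
  ∀ a ∈ W, ∀ b ∈ W, G.Adj a b → ∃ s ⊆ W, a ∈ s ∧ b ∈ s ∧ stabilityOn G W < s.card ∧
    ∀ x ∈ s, ∀ y ∈ s, G.Adj x y → x = a ∧ y = b ∨ x = b ∧ y = a

/-- The stable set counts that single out the hub of a Turán-connected graph on `m + 1` vertices
with `b + 1` cliques. -/
def IsHub [DecidableEq V] (G : SimpleGraph V) (W : Finset V) (m b : ℕ) (v : V) : Prop :=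
  stableCount G (W.erase v) = turanCount m (b + 1) ∧ stableCount G (awayFrom G W v) = hubCount m b

/-- The subgraph induced by `W` is a cycle on five vertices. -/
def IsPentagonOn (G : SimpleGraph V) (W : Finset V) : Prop :=
  ∃ p : Fin 5 → V, Function.Injective p ∧ (∀ w, w ∈ W ↔ w ∈ Set.range p) ∧
    ∀ i j, G.Adj (p i) (p j) ↔ j = i + 1 ∨ i = j + 1

theorem IsConnectedOn.exists_adj (h : IsConnectedOn G W) (hW : 1 < W.card) {v : V} (hv : v ∈ W) :
    ∃ u ∈ W, G.Adj v u := by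
  obtain ⟨a, ha, b, hb, -, hab⟩ := h.2 {v} (by simpa) (by simp) fun h => by
    rw [← h] at hW; simp at hW
  rw [Finset.mem_singleton] at ha
  exact ⟨b, hb, ha ▸ hab⟩

theorem IsConnectedOn.stabilityOn_lt_card (h : IsConnectedOn G W) (hW : 1 < W.card) :
    stabilityOn G W < W.card := by
  refine lt_of_le_of_ne stabilityOn_le_card fun heq => ?_
  obtain ⟨s, hs, hc⟩ := exists_card_eq_stabilityOn G W
  rw [mem_stableSets] at hs
  obtain rfl := Finset.eq_of_subset_of_card_le hs.1 (by omega)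
  obtain ⟨v, hv⟩ := h.1
  obtain ⟨u, hu, huv⟩ := h.exists_adj hW hv
  exact hs.2 v hv u hu huv

/-- A critical connected graph has no cut vertex. If v separated A from B, take neighbours a in A
and b in B, and sets S and T larger than α whose only edges are va and vb. Exchanging their parts
gives the stable sets {v} ∪ (T ∩ A) ∪ (S ∩ B) and (S ∩ A) ∪ (T ∩ B), of total size |S| + |T| - 1 >
2α. -/
theorem IsConnectedOn.erase [DecidableEq V] (h : IsConnectedOn G W)
    (hcr : IsStabilityCriticalOn G W) {v : V} (hv : v ∈ W) (hne : (W.erase v).Nonempty) :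
    IsConnectedOn G (W.erase v) := by
  refine ⟨hne, fun A hA hAne hAW => ?_⟩
  by_contra! hcon
  set B := (W.erase v) \ A with hB
  have hBne : B.Nonempty := Finset.sdiff_nonempty.2 fun h => hAW (hA.antisymm h)
  have hAW' : ∀ x ∈ A, x ∈ W ∧ x ≠ v := fun x hx =>
    ⟨Finset.mem_of_mem_erase (hA hx), Finset.ne_of_mem_erase (hA hx)⟩
  have hBW : ∀ x, x ∈ B ↔ x ∈ W ∧ x ≠ v ∧ x ∉ A := fun x => by
    simp only [hB, Finset.mem_sdiff, Finset.mem_erase]; tauto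
  have hAB : ∀ x ∈ A, ∀ y ∈ B, ¬G.Adj x y := fun x hx y hy =>
    hcon x hx y (Finset.mem_erase.2 ⟨((hBW y).1 hy).2.1, ((hBW y).1 hy).1⟩) ((hBW y).1 hy).2.2
  obtain ⟨a, ha, hav⟩ : ∃ a ∈ A, G.Adj v a := by
    obtain ⟨a, ha, b, hb, hbA, hab⟩ := h.2 A (fun x hx => (hAW' x hx).1) hAne
      (fun h => (hAW' v (h ▸ hv)).2 rfl)
    refine ⟨a, ha, ?_⟩
    by_cases hbv : b = v
    · exact hbv ▸ hab.symm
    · exact absurd hab (hAB a ha b ((hBW b).2 ⟨hb, hbv, hbA⟩))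
  obtain ⟨b, hb, hbv⟩ : ∃ b ∈ B, G.Adj v b := by
    obtain ⟨b, hb, a, ha, haB, hab⟩ := h.2 B (fun x hx => ((hBW x).1 hx).1) hBne
      (fun h => ((hBW v).1 (h ▸ hv)).2.1 rfl)
    refine ⟨b, hb, ?_⟩
    by_cases hav : a = v
    · exact hav ▸ hab.symm
    · refine absurd hab.symm (hAB a ?_ b hb)
      by_contra haA
      exact haB ((hBW a).2 ⟨ha, hav, haA⟩)
  obtain ⟨S, hSW, hvS, haS, hSc, hS⟩ := hcr v hv a (hAW' a ha).1 hav
  obtain ⟨T, hTW, hvT, hbT, hTc, hT⟩ := hcr v hv b ((hBW b).1 hb).1 hbv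
  have hdisj : Disjoint A B := Finset.disjoint_sdiff
  have hsplit : ∀ U ⊆ W, v ∈ U → U.card = (U ∩ A).card + (U ∩ B).card + 1 := by
    intro U hU hvU
    rw [← Finset.card_union_of_disjoint
      (hdisj.mono Finset.inter_subset_right Finset.inter_subset_right),
      ← Finset.inter_union_distrib_left, ← Finset.card_erase_add_one hvU]
    congr 2
    ext x
    have h1 := @hU x
    have h2 := hAW' x
    have h3 := hBW x
    simp only [Finset.mem_erase, Finset.mem_inter, Finset.mem_union]
    tauto
  have haB : a ∉ B := fun h => ((hBW a).1 h).2.2 ha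
  have hbA : b ∉ A := ((hBW b).1 hb).2.2
  have hvA : v ∉ A := fun h => (hAW' v h).2 rfl
  have hvB : v ∉ B := fun h => ((hBW v).1 h).2.1 rfl
  have k1 : insert v (T ∩ A ∪ S ∩ B) ∈ stableSets G W := by
    rw [mem_stableSets]
    refine ⟨Finset.insert_subset hv (Finset.union_subset
      (Finset.inter_subset_left.trans hTW) (Finset.inter_subset_left.trans hSW)), ?_⟩
    have e : ∀ x ∈ T ∩ A ∪ S ∩ B, ¬G.Adj v x := by
      intro x hx hvx
      simp only [Finset.mem_union, Finset.mem_inter] at hx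
      rcases hx with hx | hx
      · rcases hT v hvT x hx.1 hvx with h | h
        · exact hbA (h.2 ▸ hx.2)
        · exact hvA (h.2 ▸ hx.2)
      · rcases hS v hvS x hx.1 hvx with h | h
        · exact haB (h.2 ▸ hx.2)
        · exact hvB (h.2 ▸ hx.2)
    intro x hx y hy hxy
    rw [Finset.mem_insert] at hx hy
    rcases hx with rfl | hx <;> rcases hy with rfl | hy
    · exact hxy.ne rfl
    · exact e y hy hxy
    · exact e x hx hxy.symm
    · simp only [Finset.mem_union, Finset.mem_inter] at hx hy
      rcases hx with hx | hx <;> rcases hy with hy | hy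
      · rcases hT x hx.1 y hy.1 hxy with h | h
        · exact hvA (h.1 ▸ hx.2)
        · exact hvA (h.2 ▸ hy.2)
      · exact hAB x hx.2 y hy.2 hxy
      · exact hAB y hy.2 x hx.2 hxy.symm
      · rcases hS x hx.1 y hy.1 hxy with h | h
        · exact hvB (h.1 ▸ hx.2)
        · exact hvB (h.2 ▸ hy.2)
  have k2 : S ∩ A ∪ T ∩ B ∈ stableSets G W := by
    rw [mem_stableSets]
    refine ⟨Finset.union_subset
      (Finset.inter_subset_left.trans hSW) (Finset.inter_subset_left.trans hTW), ?_⟩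
    intro x hx y hy hxy
    simp only [Finset.mem_union, Finset.mem_inter] at hx hy
    rcases hx with hx | hx <;> rcases hy with hy | hy
    · rcases hS x hx.1 y hy.1 hxy with h | h
      · exact hvA (h.1 ▸ hx.2)
      · exact hvA (h.2 ▸ hy.2)
    · exact hAB x hx.2 y hy.2 hxy
    · exact hAB y hy.2 x hx.2 hxy.symm
    · rcases hT x hx.1 y hy.1 hxy with h | h
      · exact hvB (h.1 ▸ hx.2)
      · exact hvB (h.2 ▸ hy.2)
  have k1' := card_le_stabilityOn k1
  have k2' := card_le_stabilityOn k2
  rw [Finset.card_insert_of_notMem (by simp [hvA, hvB]), Finset.card_union_of_disjoint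
    (hdisj.mono Finset.inter_subset_right Finset.inter_subset_right)] at k1'
  rw [Finset.card_union_of_disjoint
    (hdisj.mono Finset.inter_subset_right Finset.inter_subset_right)] at k2'
  have e1 := hsplit S hSW hvS
  have e2 := hsplit T hTW hvT
  omega

/-- A set larger than α whose only edge is at v becomes stable without v and still has at least α
elements. -/
theorem IsConnectedOn.stabilityOn_erase [DecidableEq V] (h : IsConnectedOn G W)
    (hcr : IsStabilityCriticalOn G W) {v : V} (hv : v ∈ W) (hW : 1 < W.card) :
    stabilityOn G (W.erase v) = stabilityOn G W := by
  refine le_antisymm (stabilityOn_mono (W.erase_subset v)) ?_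
  obtain ⟨u, hu, hvu⟩ := h.exists_adj hW hv
  obtain ⟨S, hSW, hvS, -, hSc, hS⟩ := hcr v hv u hu hvu
  have : S.erase v ∈ stableSets G (W.erase v) := by
    rw [mem_stableSets]
    refine ⟨Finset.erase_subset_erase v hSW, fun x hx y hy hxy => ?_⟩
    rw [Finset.mem_erase] at hx hy
    rcases hS x hx.2 y hy.2 hxy with h | h
    · exact hx.1 h.1
    · exact hy.1 h.2
  have h1 := card_le_stabilityOn this
  rw [Finset.card_erase_of_mem hvS] at h1
  omega

/-- A part of a connected graph that is joined to the rest by a single edge is connected. -/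
theorem IsConnectedOn.of_bridge {A B : Finset V} [DecidableEq V] (h : IsConnectedOn G (A ∪ B))
    {a b : V} (ha : a ∈ A)
    (hab : ∀ x ∈ A, ∀ y ∈ B, G.Adj x y → x = a ∧ y = b) : IsConnectedOn G A := by
  -- A part that avoids a cannot be left through the bridge. A part that contains a is handled
  -- through its complement in A.
  have key : ∀ X ⊆ A, X.Nonempty → a ∉ X → ∃ x ∈ X, ∃ y ∈ A, y ∉ X ∧ G.Adj x y := by
    intro X hX hXne haX
    obtain ⟨x, hx, y, hy, hyX, hxy⟩ := h.2 X (hX.trans Finset.subset_union_left) hXne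
      (fun h => haX (h ▸ Finset.mem_union_left _ ha))
    refine ⟨x, hx, y, ?_, hyX, hxy⟩
    rcases Finset.mem_union.1 hy with hy | hy
    · exact hy
    · exact absurd (hab x (hX hx) y hy hxy).1 fun h => haX (h ▸ hx)
  refine ⟨⟨a, ha⟩, fun X hX hXne hXA => ?_⟩
  by_cases haX : a ∈ X
  · obtain ⟨x, hx, y, hy, hyX, hxy⟩ := key (A \ X) Finset.sdiff_subset
      (Finset.sdiff_nonempty.2 fun h => hXA (hX.antisymm h))
      (fun h => (Finset.mem_sdiff.1 h).2 haX)
    rw [Finset.mem_sdiff] at hx hyX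
    refine ⟨y, ?_, x, hx.1, hx.2, hxy.symm⟩
    by_contra hyX'
    exact hyX ⟨hy, hyX'⟩
  · exact key X hX hXne haX

/-- The bound of the theorem for connected graphs. -/
def SatisfiesBound (G : SimpleGraph V) (W : Finset V) : Prop :=
  IsConnectedOn G W → ∀ m b, W.card = m + 1 → stabilityOn G W = b + 1 →
    stableCount G W ≤ turanConnectedCount m b

/-- Here x stands for F(G - v) and y for F(G - N[v]). Only x and x + y are bounded, since y alone
may exceed the hub count. Written as (x₁ + y₁)x₂ + x₁y₂, the expression is monotone in x₁ and x₁ +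
y₁; the second pair is then replaced in the same way. -/
theorem join_arith {x₁ y₁ x₂ y₂ A₁ Q₁ A₂ Q₂ : ℕ} (hx₂ : 0 < x₂) (hy₂ : 0 < y₂)
    (hA₁ : 0 < A₁) (hQ₁ : 0 < Q₁) (h₁ : x₁ ≤ A₁) (h₁' : x₁ + y₁ ≤ A₁ + Q₁) (h₂ : x₂ ≤ A₂)
    (h₂' : x₂ + y₂ ≤ A₂ + Q₂) :
    x₁ * (x₂ + y₂) + y₁ * x₂ ≤ A₁ * (A₂ + Q₂) + Q₁ * A₂ ∧
    (x₁ * (x₂ + y₂) + y₁ * x₂ = A₁ * (A₂ + Q₂) + Q₁ * A₂ →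
      x₁ = A₁ ∧ y₁ = Q₁ ∧ x₂ = A₂ ∧ y₂ = Q₂) := by
  have e1 := Nat.mul_le_mul_right y₂ h₁
  have e2 := Nat.mul_le_mul_right x₂ h₁'
  have e3 := Nat.mul_le_mul_left Q₁ h₂
  have e4 := Nat.mul_le_mul_left A₁ h₂'
  have f1 : x₁ * (x₂ + y₂) + y₁ * x₂ = (x₁ + y₁) * x₂ + x₁ * y₂ := by ring
  have f2 : (A₁ + Q₁) * x₂ + A₁ * y₂ = A₁ * (x₂ + y₂) + Q₁ * x₂ := by ring
  refine ⟨by omega, fun heq => ?_⟩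
  have g1 : x₁ = A₁ := Nat.eq_of_mul_eq_mul_right hy₂ (by omega)
  have g2 : x₁ + y₁ = A₁ + Q₁ := Nat.eq_of_mul_eq_mul_right hx₂ (by omega)
  have g3 : x₂ = A₂ := Nat.eq_of_mul_eq_mul_left hQ₁ (by omega)
  have g4 : x₂ + y₂ = A₂ + Q₂ := Nat.eq_of_mul_eq_mul_left hA₁ (by omega)
  omega

/-! ### Two graphs joined by an edge -/

section Join

variable [DecidableEq V] {A B : Finset V} {a b : V}

theorem stableCount_join_erase (hd : Disjoint A B) (ha : a ∈ A)
    (hab : ∀ x ∈ A, ∀ y ∈ B, G.Adj x y → x = a ∧ y = b) :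
    stableCount G ((A ∪ B).erase a) = stableCount G (A.erase a) * stableCount G B := by
  have haB : a ∉ B := Finset.disjoint_left.1 hd ha
  rw [Finset.erase_union_distrib, Finset.erase_eq_of_notMem haB]
  convert stableCount_union (hd.mono_left (A.erase_subset a)) ?_
  intro x hx y hy hxy
  exact Finset.ne_of_mem_erase hx (hab x (Finset.mem_of_mem_erase hx) y hy hxy).1

theorem stableCount_join_awayFrom (hd : Disjoint A B) (ha : a ∈ A) (hadj : G.Adj a b)
    (hab : ∀ x ∈ A, ∀ y ∈ B, G.Adj x y → x = a ∧ y = b) :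
    stableCount G (awayFrom G (A ∪ B) a) =
      stableCount G (awayFrom G A a) * stableCount G (B.erase b) := by
  have haB : a ∉ B := Finset.disjoint_left.1 hd ha
  rw [show awayFrom G (A ∪ B) a = awayFrom G A a ∪ B.erase b from ?_]
  · convert stableCount_union (hd.mono (awayFrom_subset a) (B.erase_subset b)) ?_
    intro x hx y hy hxy
    exact (mem_awayFrom.1 hx).2.1
      (hab x (awayFrom_subset a hx) y (Finset.mem_of_mem_erase hy) hxy).1
  · ext x
    simp only [mem_awayFrom, Finset.mem_union, Finset.mem_erase]
    constructor
    · rintro ⟨hx | hx, h1, h2⟩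
      · exact Or.inl ⟨hx, h1, h2⟩
      · exact Or.inr ⟨fun h => h2 (h ▸ hadj), hx⟩
    · rintro (⟨hx, h1, h2⟩ | ⟨h1, hx⟩)
      · exact ⟨Or.inl hx, h1, h2⟩
      · exact ⟨Or.inr hx, fun h => haB (h ▸ hx), fun h => h1 (hab a ha x hx h).2⟩

/-- When the second side has the counts of a clique with any vertex as hub, the hub of the first
side serves the union: both summands at a are bounded by the required values, and equality of the
sums forces equality in each. -/
theorem isHub_of_join (hd : Disjoint A B) (ha : a ∈ A) (hb : b ∈ B) (hadj : G.Adj a b)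
    (hab : ∀ x ∈ A, ∀ y ∈ B, G.Adj x y → x = a ∧ y = b) {m₁ b₁ m₂ : ℕ} (hm₁ : b₁ ≤ m₁)
    (hk : m₂ ≤ m₁ / (b₁ + 1)) (h₁ : IsHub G A m₁ b₁ a) (h₂ : IsHub G B m₂ 0 b)
    (heq : stableCount G (A ∪ B) = turanConnectedCount (m₁ + m₂ + 1) (b₁ + 1)) :
    IsHub G (A ∪ B) (m₁ + m₂ + 1) (b₁ + 1) a := by
  have e := stableCount_eq_erase_add (G := G) (Finset.mem_union_left B ha)
  have e1 := stableCount_join_erase hd ha hab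
  have e2 := stableCount_join_awayFrom hd ha hadj hab
  have e3 := stableCount_eq_erase_add (G := G) hb
  have l1 := turanCount_mul_le m₁ (m₂ + 1) (b₁ + 1) 1
  have l2 := hubCount_mul_le (b₂ := 0) (m₂ := m₂) hm₁ (Nat.zero_le _) (by simpa using hk)
  have h0 : hubCount m₂ 0 = 1 := by simp [hubCount, Nat.mod_one]
  have e1' : stableCount G ((A ∪ B).erase a) = turanCount m₁ (b₁ + 1) * turanCount (m₂ + 1) 1 := by
    have q1 := h₂.1
    have q2 := h₂.2
    rw [e1, h₁.1, turanCount_one_right]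
    congr 1
    rw [zero_add, turanCount_one_right] at q1
    rw [h0] at q2
    convert e3 using 1
    rw [← q1, ← q2]
    congr!
  have e2' : stableCount G (awayFrom G (A ∪ B) a) =
      hubCount m₁ b₁ * turanCount m₂ 1 := by
    rw [e2, h₁.2, h₂.1]
  have ee : stableCount G (A ∪ B) =
      stableCount G ((A ∪ B).erase a) + stableCount G (awayFrom G (A ∪ B) a) := by
    convert e
  rw [heq, turanConnectedCount] at ee
  rw [show m₁ + (m₂ + 1) = m₁ + m₂ + 1 by ring] at l1
  simp only [Nat.sub_zero, zero_add, add_zero] at l2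
  unfold IsHub
  omega

/-- By the recurrence at a, the union has F(A - a)F(B) + F(A - N[a])F(B - b) stable sets.
`join_arith` replaces the sides by Turán-connected graphs with hubs a and b, and
`turanConnectedCount_join` merges these. -/
theorem join_bound (hd : Disjoint A B) (ha : a ∈ A) (hb : b ∈ B) (hadj : G.Adj a b)
    (hab : ∀ x ∈ A, ∀ y ∈ B, G.Adj x y → x = a ∧ y = b) {m₁ b₁ m₂ b₂ : ℕ}
    (hA : A.card = m₁ + 1) (hB : B.card = m₂ + 1) (hsA : stabilityOn G A = b₁ + 1)
    (hsB : stabilityOn G B = b₂ + 1)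
    (hfA : stableCount G A ≤ turanConnectedCount m₁ b₁)
    (hfB : stableCount G B ≤ turanConnectedCount m₂ b₂)
    (hk : m₂ / (b₂ + 1) ≤ m₁ / (b₁ + 1)) :
    stableCount G (A ∪ B) ≤ turanConnectedCount (m₁ + m₂ + 1) (b₁ + b₂ + 1) ∧
    (stableCount G (A ∪ B) = turanConnectedCount (m₁ + m₂ + 1) (b₁ + b₂ + 1) →
      ∃ v ∈ A ∪ B, IsHub G (A ∪ B) (m₁ + m₂ + 1) (b₁ + b₂ + 1) v) := by
  have hm₁ : b₁ ≤ m₁ := by have := stabilityOn_le_card (G := G) (W := A); omega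
  have hm₂ : b₂ ≤ m₂ := by have := stabilityOn_le_card (G := G) (W := B); omega
  have e : stableCount G (A ∪ B) =
      stableCount G ((A ∪ B).erase a) + stableCount G (awayFrom G (A ∪ B) a) := by
    convert stableCount_eq_erase_add (G := G) (Finset.mem_union_left B ha)
  have eA : stableCount G A = stableCount G (A.erase a) + stableCount G (awayFrom G A a) := by
    convert stableCount_eq_erase_add (G := G) ha
  have eB : stableCount G B = stableCount G (B.erase b) + stableCount G (awayFrom G B b) := by
    convert stableCount_eq_erase_add (G := G) hb
  rw [stableCount_join_erase hd ha hab, stableCount_join_awayFrom hd ha hadj hab, eB] at e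
  have tA : stableCount G (A.erase a) ≤ turanCount m₁ (b₁ + 1) := by
    have := stableCount_le_turanCount (hsA ▸ stabilityOn_mono (G := G) (A.erase_subset a))
    rwa [Finset.card_erase_of_mem ha, hA, Nat.add_sub_cancel] at this
  have tB : stableCount G (B.erase b) ≤ turanCount m₂ (b₂ + 1) := by
    have := stableCount_le_turanCount (hsB ▸ stabilityOn_mono (G := G) (B.erase_subset b))
    rwa [Finset.card_erase_of_mem hb, hB, Nat.add_sub_cancel] at this
  obtain ⟨j1, j2⟩ := join_arith (y₁ := stableCount G (awayFrom G A a))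
    (y₂ := stableCount G (awayFrom G B b))
    stableCount_pos stableCount_pos (turanCount_pos m₁ (b₁ + 1)) (hubCount_pos hm₁) tA
    (eA ▸ hfA) tB (eB ▸ hfB)
  obtain ⟨k1, k2⟩ := turanConnectedCount_join hm₁ hm₂ hk
  rw [e]
  refine ⟨j1.trans k1, fun heq => ?_⟩
  obtain ⟨x1, y1, x2, y2⟩ := j2 (le_antisymm j1 (heq ▸ k1))
  have hubA : IsHub G A m₁ b₁ a := ⟨x1, y1⟩
  have hubB : IsHub G B m₂ b₂ b := ⟨x2, y2⟩
  rw [← e] at heq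
  -- In the second case the side A has b₁ = 0 and both quotients agree, so the sides exchange roles
  -- and b is the hub.
  rcases k2 (le_antisymm k1 (heq ▸ e ▸ j1)) with rfl | ⟨rfl, hkk⟩
  · refine ⟨a, Finset.mem_union_left _ ha, ?_⟩
    exact isHub_of_join hd ha hb hadj hab hm₁ (by simpa using hk) hubA hubB heq
  · refine ⟨b, Finset.mem_union_right _ hb, ?_⟩
    have := isHub_of_join hd.symm hb ha hadj.symm
      (fun x hx y hy hxy => (hab y hy x hx hxy.symm).symm) hm₂ (by simpa using hkk.le) hubB hubA
      (by rw [Finset.union_comm, add_comm m₂]; simpa using heq)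
    rw [Finset.union_comm, add_comm m₁, zero_add]
    exact this

end Join

end Connected

/-! ### The regular extremal case: the pentagon -/

section Extremal

variable {V : Type*} {G : SimpleGraph V} {W : Finset V}

theorem exists_clique_component {q b : ℕ} {v w : V} (hcard : (awayFrom G W v).card = q * b)
    (hs : stabilityOn G (awayFrom G W v) ≤ b)
    (hc : stableCount G (awayFrom G W v) = turanCount (q * b) b) (hw : w ∈ awayFrom G W v) :
    ∃ D ⊆ awayFrom G W v, w ∈ D ∧ D.card = q ∧ (∀ x ∈ D, ∀ y ∈ D, x ≠ y → G.Adj x y) ∧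
      ∀ x ∈ D, ∀ y ∈ awayFrom G W v, G.Adj x y → y ∈ D := by
  obtain ⟨c, hcol⟩ := exists_isCliqueColoring hs (by rw [hc, hcard])
  refine ⟨(awayFrom G W v).filter fun x => c x = c w, Finset.filter_subset _ _, by simpa, ?_, ?_,
    ?_⟩
  · refine eq_of_balanced (J := Finset.range b)
      (s := fun j => ((awayFrom G W v).filter fun x => c x = j).card) ?_ ?_ (hcol.mem w hw)
    · rw [hcol.sum_card, hcard, Finset.card_range]
    · intro i hi j hj
      exact hcol.balanced (by rw [hc, hcard, Finset.card_range]) hi hj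
  · intro x hx y hy hxy
    rw [Finset.mem_filter] at hx hy
    exact (hcol.adj_iff x hx.1 y hy.1 hxy).2 (hx.2.trans hy.2.symm)
  · intro x hx y hy hxy
    rw [Finset.mem_filter] at hx ⊢
    exact ⟨hy, ((hcol.adj_iff x hx.1 y hy hxy.ne).1 hxy).symm.trans hx.2⟩

theorem IsPentagonOn.card_eq (h : IsPentagonOn G W) : W.card = 5 := by
  classical
  obtain ⟨p, hp, hW, -⟩ := h
  have : W = Finset.univ.image p := by
    ext w
    simp [hW]
  rw [this, Finset.card_image_of_injective _ hp, Finset.card_univ, Fintype.card_fin]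

/-- Let C be a q-clique among the non-neighbours of v. By regularity each x in C has a single
neighbour y(x) outside C, and it lies in N(v). The clique of v among the non-neighbours of x is v
with N(v) minus y(x), so N(v) minus y(x) is a clique. Degree counts at vertices y(x) exclude a
constant y and a third vertex of C, so q = 2, and v, y(x₁), x₁, x₂, y(x₂) form a cycle. -/
theorem isPentagonOn_of_regular {q b : ℕ} (hW : IsConnectedOn G W) (hq : 1 ≤ q) (hb : 1 ≤ b)
    (hdeg : ∀ v ∈ W, (neighborsIn G W v).card = q)
    (haway : ∀ v ∈ W, (awayFrom G W v).card = q * b ∧ stabilityOn G (awayFrom G W v) ≤ b ∧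
      stableCount G (awayFrom G W v) = turanCount (q * b) b) : q = 2 ∧ IsPentagonOn G W := by
  classical
  have hmax : ∀ v ∈ W, ∀ Z ⊆ W, (∀ z ∈ Z, G.Adj v z) → Z.card ≤ q := fun v hv Z hZ h => by
    rw [← hdeg v hv]
    exact Finset.card_le_card fun z hz => mem_neighborsIn.2 ⟨hZ hz, h z hz⟩
  obtain ⟨v, hv⟩ := hW.1
  obtain ⟨w, hw⟩ : (awayFrom G W v).Nonempty := by
    rw [← Finset.card_pos, (haway v hv).1]; positivity
  obtain ⟨C, hC, hwC, hCcard, hCadj, hCout⟩ := exists_clique_component (haway v hv).1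
    (haway v hv).2.1 (haway v hv).2.2 hw
  have hCW : ∀ x ∈ C, x ∈ W ∧ x ≠ v ∧ ¬G.Adj v x := fun x hx => mem_awayFrom.1 (hC hx)
  have hvC : v ∉ C := fun h => (hCW v h).2.1 rfl
  have hy : ∀ x ∈ C, ∃ y ∈ neighborsIn G W v, neighborsIn G W x = insert y (C.erase x) := by
    intro x hx
    have hsub : C.erase x ⊆ neighborsIn G W x := fun z hz => by
      rw [Finset.mem_erase] at hz
      exact mem_neighborsIn.2 ⟨(hCW z hz.2).1, hCadj x hx z hz.2 hz.1.symm⟩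
    have h1 := Finset.card_sdiff_of_subset hsub
    rw [hdeg x (hCW x hx).1, Finset.card_erase_of_mem hx, hCcard,
      show q - (q - 1) = 1 by omega, Finset.card_eq_one] at h1
    obtain ⟨y, hy⟩ := h1
    have hymem : y ∈ neighborsIn G W x \ C.erase x := by rw [hy]; simp
    rw [Finset.mem_sdiff, mem_neighborsIn, Finset.mem_erase] at hymem
    obtain ⟨⟨hyW, hxy⟩, hyC⟩ := hymem
    have hyC' : y ∉ C := fun h => hyC ⟨hxy.ne', h⟩
    refine ⟨y, ?_, ?_⟩
    · rw [mem_neighborsIn]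
      refine ⟨hyW, ?_⟩
      by_contra hvy
      have hyv : y ≠ v := by rintro rfl; exact (hCW x hx).2.2 hxy.symm
      exact hyC' (hCout x hx y (mem_awayFrom.2 ⟨hyW, hyv, hvy⟩) hxy)
    · rw [← Finset.sdiff_union_of_subset hsub, hy]; rfl
  choose! y hyv hyN using hy
  have hyW : ∀ x ∈ C, y x ∈ W := fun x hx => (mem_neighborsIn.1 (hyv x hx)).1
  have hvy : ∀ x ∈ C, G.Adj v (y x) := fun x hx => (mem_neighborsIn.1 (hyv x hx)).2
  have hxy : ∀ x ∈ C, G.Adj x (y x) := fun x hx => by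
    have : y x ∈ neighborsIn G W x := by rw [hyN x hx]; simp
    exact (mem_neighborsIn.1 this).2
  have hNC : ∀ z ∈ neighborsIn G W v, z ∉ C := fun z hz hzC =>
    (hCW z hzC).2.2 (mem_neighborsIn.1 hz).2
  have hvN : v ∉ neighborsIn G W v := fun h => (mem_neighborsIn.1 h).2.ne rfl
  have hclique : ∀ x ∈ C, ∀ z ∈ neighborsIn G W v, ∀ z' ∈ neighborsIn G W v, z ≠ y x → z' ≠ y x →
      z ≠ z' → G.Adj z z' := by
    intro x hx
    have hxW := (hCW x hx).1
    obtain ⟨D, hD, hvD, hDcard, hDadj, hDout⟩ := exists_clique_component (haway x hxW).1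
      (haway x hxW).2.1 (haway x hxW).2.2
      (mem_awayFrom.2 ⟨hv, (hCW x hx).2.1.symm, fun h => (hCW x hx).2.2 h.symm⟩)
    have hsub : D.erase v ⊆ (neighborsIn G W v).erase (y x) := by
      intro z hz
      rw [Finset.mem_erase] at hz
      rw [Finset.mem_erase, mem_neighborsIn]
      have hz' := mem_awayFrom.1 (hD hz.2)
      exact ⟨fun h => hz'.2.2 (h ▸ hxy x hx), hz'.1, hDadj v hvD z hz.2 hz.1.symm⟩
    have heq := Finset.eq_of_subset_of_card_le hsub (by
      rw [Finset.card_erase_of_mem (hyv x hx), Finset.card_erase_of_mem hvD, hdeg v hv, hDcard])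
    intro z hz z' hz' hzy hzy' hne
    have h1 : z ∈ D.erase v := heq ▸ Finset.mem_erase.2 ⟨hzy, hz⟩
    have h2 : z' ∈ D.erase v := heq ▸ Finset.mem_erase.2 ⟨hzy', hz'⟩
    exact hDadj z (Finset.mem_of_mem_erase h1) z' (Finset.mem_of_mem_erase h2) hne
  -- A common neighbour y(x) of all of C would be adjacent to C and v, hence to q + 1 vertices.
  obtain ⟨x₁, hx₁, x₂, hx₂, hne⟩ : ∃ x₁ ∈ C, ∃ x₂ ∈ C, y x₁ ≠ y x₂ := by
    by_contra! hall
    have := hmax (y w) (hyW w hwC) (insert v C)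
      (Finset.insert_subset hv fun x hx => (hCW x hx).1) (by
        intro z hz
        rcases Finset.mem_insert.1 hz with rfl | hz
        · exact (hvy w hwC).symm
        · exact hall w hwC z hz ▸ (hxy z hz).symm)
    rw [Finset.card_insert_of_notMem hvC, hCcard] at this
    omega
  have hx₁₂ : x₁ ≠ x₂ := fun h => hne (by rw [h])
  have hpair : ({x₁, x₂} : Finset V) ⊆ C := by simp [Finset.insert_subset_iff, hx₁, hx₂]
  have hCeq : C = {x₁, x₂} := by
    by_contra hCne
    obtain ⟨x₃, hx₃, hx₃n⟩ := Finset.exists_of_ssubset (hpair.ssubset_of_ne (Ne.symm hCne))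
    simp only [Finset.mem_insert, Finset.mem_singleton, not_or] at hx₃n
    -- If u and u' share y(u), that vertex is adjacent to v, u, u' and to N(v) minus y(u) and
    -- y(u''): 1 + 2 + (q - 2) neighbours.
    have two : ∀ u ∈ C, ∀ u' ∈ C, ∀ u'' ∈ C, u ≠ u' → y u = y u' → y u'' ≠ y u → False := by
      intro u hu u' hu' u'' hu'' huu' hyu hyu''
      have h1 := hmax (y u) (hyW u hu)
        (insert v (((neighborsIn G W v).erase (y u)).erase (y u'') ∪ {u, u'})) (by
          refine Finset.insert_subset hv (Finset.union_subset ?_ ?_)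
          · exact (Finset.erase_subset _ _).trans
              ((Finset.erase_subset _ _).trans (neighborsIn_subset v))
          · simp [Finset.insert_subset_iff, (hCW u hu).1, (hCW u' hu').1]) (by
          intro z hz
          simp only [Finset.mem_insert, Finset.mem_union, Finset.mem_erase,
            Finset.mem_singleton] at hz
          rcases hz with rfl | ⟨hz1, hz2, hz3⟩ | rfl | rfl
          · exact (hvy u hu).symm
          · exact hclique u'' hu'' _ (hyv u hu) z hz3 hyu''.symm hz1 hz2.symm
          · exact (hxy z hu).symm
          · exact hyu ▸ (hxy z hu').symm)
      rw [Finset.card_insert_of_notMem (by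
          simp only [Finset.mem_union, Finset.mem_erase, Finset.mem_insert, Finset.mem_singleton]
          rintro (⟨-, -, h⟩ | rfl | rfl)
          · exact hvN h
          · exact hvC hu
          · exact hvC hu'),
        Finset.card_union_of_disjoint (by
          rw [Finset.disjoint_left]
          intro z hz hz'
          have hzN := Finset.mem_of_mem_erase (Finset.mem_of_mem_erase hz)
          simp only [Finset.mem_insert, Finset.mem_singleton] at hz'
          rcases hz' with rfl | rfl
          · exact hNC _ hzN hu
          · exact hNC _ hzN hu'),
        Finset.card_pair huu', Finset.card_erase_of_mem
          (Finset.mem_erase.2 ⟨hyu'', hyv u'' hu''⟩), Finset.card_erase_of_mem (hyv u hu),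
        hdeg v hv] at h1
      omega
    by_cases h31 : y x₃ = y x₁
    · exact two x₃ hx₃ x₁ hx₁ x₂ hx₂ hx₃n.1 h31 (h31 ▸ hne.symm)
    by_cases h32 : y x₃ = y x₂
    · exact two x₃ hx₃ x₂ hx₂ x₁ hx₁ hx₃n.2 h32 (h32 ▸ hne)
    -- With three distinct values, y(x₁) is adjacent to v, x₁ and the other q - 1 vertices of N(v).
    -- The clique obtained from x₃ covers all of them except y(x₃), which the clique from x₂ covers.
    have h1 := hmax (y x₁) (hyW x₁ hx₁) (insert v (insert x₁ ((neighborsIn G W v).erase (y x₁))))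
      (by
        refine Finset.insert_subset hv (Finset.insert_subset (hCW x₁ hx₁).1 ?_)
        exact (Finset.erase_subset _ _).trans (neighborsIn_subset v))
      (by
        intro z hz
        simp only [Finset.mem_insert, Finset.mem_erase] at hz
        rcases hz with rfl | rfl | ⟨hz1, hz2⟩
        · exact (hvy x₁ hx₁).symm
        · exact (hxy z hx₁).symm
        · by_cases hz3 : z = y x₃
          · exact hclique x₂ hx₂ _ (hyv x₁ hx₁) z hz2 hne (fun h => h32 (hz3 ▸ h)) hz1.symm
          · exact hclique x₃ hx₃ _ (hyv x₁ hx₁) z hz2 (Ne.symm h31) hz3 hz1.symm)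
    rw [Finset.card_insert_of_notMem (by
        simp only [Finset.mem_insert, Finset.mem_erase]
        rintro (rfl | ⟨-, h⟩)
        · exact hvC hx₁
        · exact hvN h),
      Finset.card_insert_of_notMem (fun h => hNC x₁ (Finset.mem_of_mem_erase h) hx₁),
      Finset.card_erase_of_mem (hyv x₁ hx₁), hdeg v hv] at h1
    omega
  have hq2 : q = 2 := by rw [← hCcard, hCeq, Finset.card_pair hx₁₂]
  have pairEq : ∀ u ∈ W, ∀ s t, s ∈ W → t ∈ W → s ≠ t → G.Adj u s → G.Adj u t →
      neighborsIn G W u = {s, t} := by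
    intro u hu s t hs ht hst hus hut
    symm
    apply Finset.eq_of_subset_of_card_le
    · simp [Finset.insert_subset_iff, mem_neighborsIn, hs, ht, hus, hut]
    · rw [hdeg u hu, Finset.card_pair hst, hq2]
  set p : Fin 5 → V := ![v, y x₁, x₁, x₂, y x₂] with hp
  have hpW : ∀ i, p i ∈ W := by
    intro i
    fin_cases i
    exacts [hv, hyW x₁ hx₁, (hCW x₁ hx₁).1, (hCW x₂ hx₂).1, hyW x₂ hx₂]
  have n1 := fun x hx => hNC (y x) (hyv x hx)
  have n2 : ∀ x ∈ C, y x ≠ v := fun x hx h => (hvy x hx).ne h.symm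
  have n3 : ∀ x ∈ C, ∀ x' ∈ C, y x ≠ x' := fun x hx x' hx' h => n1 x hx (h ▸ hx')
  have n4 : ∀ x ∈ C, x ≠ v := fun x hx => (hCW x hx).2.1
  have hpinj : Function.Injective p := by
    have hnd : [v, y x₁, x₁, x₂, y x₂].Nodup := by
      simp only [List.nodup_cons, List.mem_cons, List.not_mem_nil, not_or, or_false]
      exact ⟨⟨(n2 x₁ hx₁).symm, (n4 x₁ hx₁).symm, (n4 x₂ hx₂).symm, (n2 x₂ hx₂).symm⟩,
        ⟨n3 x₁ hx₁ x₁ hx₁, n3 x₁ hx₁ x₂ hx₂, hne⟩, ⟨hx₁₂, (n3 x₂ hx₂ x₁ hx₁).symm⟩,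
        (n3 x₂ hx₂ x₂ hx₂).symm, not_false, List.nodup_nil⟩
    rw [← List.nodup_ofFn]
    simpa [hp, List.ofFn_succ] using hnd
  have hN : ∀ i, neighborsIn G W (p i) = {p (i - 1), p (i + 1)} := by
    have adj : ∀ i, G.Adj (p i) (p (i + 1)) := by
      intro i
      fin_cases i
      exacts [hvy x₁ hx₁, (hxy x₁ hx₁).symm, hCadj x₁ hx₁ x₂ hx₂ hx₁₂, hxy x₂ hx₂, (hvy x₂ hx₂).symm]
    intro i
    refine pairEq _ (hpW i) _ _ (hpW _) (hpW _) (fun h => ?_) ?_ (adj i)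
    · have := hpinj h
      revert this
      fin_cases i <;> decide
    · have := adj (i - 1)
      rw [sub_add_cancel] at this
      exact this.symm
  refine ⟨hq2, p, hpinj, fun u => ⟨fun hu => ?_, ?_⟩, fun i j => ?_⟩
  · by_contra hun
    obtain ⟨a, ha, b, hb, hba, hab⟩ := hW.2 (Finset.univ.image p)
      (Finset.image_subset_iff.2 fun i _ => hpW i) (Finset.univ_nonempty.image p)
      (fun h => hun (by rw [← h] at hu; simpa using hu))
    obtain ⟨i, -, rfl⟩ := Finset.mem_image.1 ha
    have hbm : b ∈ neighborsIn G W (p i) := mem_neighborsIn.2 ⟨hb, hab⟩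
    rw [hN, Finset.mem_insert, Finset.mem_singleton] at hbm
    rcases hbm with rfl | rfl <;> exact hba (by simp)
  · rintro ⟨i, rfl⟩
    exact hpW i
  · have : G.Adj (p i) (p j) ↔ p j ∈ neighborsIn G W (p i) := by
      simp [mem_neighborsIn, hpW j]
    rw [this, hN, Finset.mem_insert, Finset.mem_singleton, hpinj.eq_iff, hpinj.eq_iff, or_comm,
      eq_sub_iff_add_eq, eq_comm (a := j + 1)]

/-! ### The induction for connected graphs -/

section Critical

theorem adj_of_deleteEdge {a b x y : V} (h : G.Adj x y)
    (h' : ¬(G.deleteEdges {s(a, b)}).Adj x y) : x = a ∧ y = b ∨ x = b ∧ y = a := by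
  rw [SimpleGraph.deleteEdges_adj, not_and, not_not] at h'
  have := h' h
  rw [Set.mem_singleton_iff, Sym2.eq_iff] at this
  exact this

variable [DecidableEq V]

/-- Criticality allows induction on W without v for every v. A degree of at least q + 1 makes the
non-neighbourhood so small that the bound is strict; if all degrees are at most q, the greedy bound
leaves only a regular graph with t = 0. -/
theorem critical_bound (hW : IsConnectedOn G W) (hcr : IsStabilityCriticalOn G W)
    (IH : ∀ U : Finset V, U.card < W.card → SatisfiesBound G U) {m b : ℕ} (hb : 1 ≤ b)
    (hcard : W.card = m + 1) (hs : stabilityOn G W = b + 1) :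
    stableCount G W ≤ turanConnectedCount m b ∧
    (stableCount G W = turanConnectedCount m b → b = 1 ∧ IsPentagonOn G W) := by
  have h2 : 1 < W.card := by
    have := stabilityOn_le_card (G := G) (W := W); omega
  have hlt := hW.stabilityOn_lt_card h2
  obtain ⟨q, t, ht, rfl⟩ : ∃ q t, t ≤ b ∧ m = q * (b + 1) + t :=
    ⟨m / (b + 1), m % (b + 1), Nat.lt_succ_iff.1 (Nat.mod_lt _ (by omega)),
      (Nat.div_add_mod' _ _).symm⟩
  have hq : 1 ≤ q := by
    rcases Nat.eq_zero_or_pos q with rfl | h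
    · omega
    · exact h
  have hqb : q * (b + 1) = q * b + q := by ring
  have hrec : ∀ v ∈ W, stableCount G W =
      stableCount G (W.erase v) + stableCount G (awayFrom G W v) := fun v hv => by
    convert stableCount_eq_erase_add hv
  have herase : ∀ v ∈ W, stableCount G (W.erase v) ≤
      turanConnectedCount (q * (b + 1) + t - 1) b := by
    intro v hv
    have hc := Finset.card_erase_of_mem hv
    refine IH _ (by omega) (hW.erase hcr hv (Finset.card_pos.1 (by omega))) _ _ (by omega) ?_
    rw [hW.stabilityOn_erase hcr hv h2, hs]
  have haway : ∀ v ∈ W, stabilityOn G (awayFrom G W v) ≤ b := fun v hv => by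
    have := stabilityOn_awayFrom_lt (G := G) hv
    omega
  by_cases hdeg : ∃ v ∈ W, q + 1 ≤ (neighborsIn G W v).card
  · obtain ⟨v, hv, hd⟩ := hdeg
    have e1 := herase v hv
    have e2 := stableCount_le_turanCount (haway v hv)
    have e3 := card_awayFrom (G := G) hv
    have e4 : turanCount (awayFrom G W v).card b ≤ turanCount (q * b + t - 1) b :=
      turanCount_mono _ (by omega)
    have e5 := turanConnectedCount_large_degree q b t ht hq hb
    have e6 := hrec v hv
    exact ⟨by omega, fun h => by omega⟩
  · push Not at hdeg
    -- An edge leaves A, and its endpoint in A loses one of its at most q neighbours.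
    have hproper : ∀ A ⊆ W, A ≠ W → A.Nonempty → ∃ a ∈ A, (neighborsIn G A a).card < q := by
      intro A hA hAW hAne
      obtain ⟨a, ha, u, hu, huA, hau⟩ := hW.2 A hA hAne hAW
      refine ⟨a, ha, lt_of_lt_of_le (Finset.card_lt_card ⟨neighborsIn_mono hA a, fun hsub => ?_⟩)
        (Nat.lt_succ_iff.1 (hdeg a (hA ha)))⟩
      exact huA (mem_neighborsIn.1 (hsub (mem_neighborsIn.2 ⟨hu, hau⟩))).1
    have hreg : ∀ v ∈ W, (neighborsIn G W v).card = q := by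
      intro v hv
      refine le_antisymm (Nat.lt_succ_iff.1 (hdeg v hv)) ?_
      -- A vertex of degree below q would make the greedy bound apply to W itself: q(b + 1) + t + 1
      -- ≤ q(b + 1).
      by_contra! hvq
      have := card_le_mul_stabilityOn (G := G) (W := W) (d := q) fun A hA hAne => by
        by_cases hAW : A = W
        · exact ⟨v, hAW ▸ hv, hAW ▸ hvq⟩
        · exact hproper A hA hAW hAne
      rw [hs] at this
      omega
    have hawc : ∀ v ∈ W, (awayFrom G W v).card = q * b + t := fun v hv => by
      have := card_awayFrom (G := G) hv
      have := hreg v hv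
      omega
    obtain ⟨v, hv⟩ := hW.1
    -- The greedy bound on the non-neighbours of v gives qb + t ≤ qb.
    obtain rfl : t = 0 := by
      have h1 := card_le_mul_stabilityOn (G := G) (W := awayFrom G W v) (d := q) fun A hA hAne =>
        hproper A (hA.trans (awayFrom_subset v))
          (fun h => (mem_awayFrom.1 (hA (h ▸ hv))).2.1 rfl) hAne
      have h2 := Nat.mul_le_mul_left q (haway v hv)
      have := hawc v hv
      omega
    rw [add_zero] at *
    have hle : ∀ v ∈ W, stableCount G (awayFrom G W v) ≤ turanCount (q * b) b := fun v hv => by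
      have := stableCount_le_turanCount (haway v hv)
      rwa [hawc v hv] at this
    have e5 := turanConnectedCount_small_degree q b hq
    refine ⟨?_, fun heq => ?_⟩
    · have := hrec v hv
      have := hle v hv
      have := herase v hv
      omega
    · obtain ⟨rfl, hp⟩ := isPentagonOn_of_regular hW hq hb hreg fun u hu =>
        ⟨hawc u hu, haway u hu, le_antisymm (hle u hu) (by
          have := hrec u hu
          have := herase u hu
          omega)⟩
      have := hp.card_eq
      exact ⟨by omega, hp⟩

theorem bound_of_stabilityOn_eq_one {m : ℕ} (hcard : W.card = m + 1) (hs : stabilityOn G W = 1) :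
    stableCount G W ≤ turanConnectedCount m 0 ∧
    (stableCount G W = turanConnectedCount m 0 → ∃ v ∈ W, IsHub G W m 0 v) := by
  have h0 : hubCount m 0 = 1 := by simp [hubCount, Nat.mod_one]
  obtain ⟨v, hv⟩ : W.Nonempty := Finset.card_pos.1 (by omega)
  have e : stableCount G W = stableCount G (W.erase v) + stableCount G (awayFrom G W v) := by
    convert stableCount_eq_erase_add hv
  have e1 := stableCount_le_turanCount (G := G) (W := W.erase v) (a := 1)
    (hs ▸ stabilityOn_mono (W.erase_subset v))
  have e2 := stabilityOn_awayFrom_lt (G := G) hv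
  have e3 := stableCount_le_turanCount (G := G) (W := awayFrom G W v) (a := 0) (by omega)
  have e4 := stableCount_pos (G := G) (W := awayFrom G W v)
  rw [Finset.card_erase_of_mem hv, hcard, Nat.add_sub_cancel] at e1
  rw [turanCount_zero_right] at e3
  unfold turanConnectedCount
  simp only [zero_add] at *
  exact ⟨by omega, fun h => ⟨v, hv, by rw [zero_add]; omega, by omega⟩⟩

/-- Without the edge ab no edge joins A to the rest B, so stability numbers add there. Since the
deletion does not raise α, α(A) + α(B) = α(W) in G as well, and the parameters of the two sides fit
`join_bound`. -/
theorem bridge_bound {A : Finset V} {a b : V} (hW : IsConnectedOn G W)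
    (IH : ∀ U : Finset V, U.card < W.card → SatisfiesBound G U)
    (hA : A ⊆ W) (ha : a ∈ A) (hb : b ∈ W) (hbA : b ∉ A) (hadj : G.Adj a b)
    (hcross : ∀ x ∈ A, ∀ y ∈ W, y ∉ A → ¬(G.deleteEdges {s(a, b)}).Adj x y)
    (hsafe : stabilityOn (G.deleteEdges {s(a, b)}) W ≤ stabilityOn G W)
    {m k : ℕ} (hcard : W.card = m + 1) (hs : stabilityOn G W = k + 1) :
    stableCount G W ≤ turanConnectedCount m k ∧
    (stableCount G W = turanConnectedCount m k → ∃ v ∈ W, IsHub G W m k v) := by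
  set B := W \ A with hB
  have hbB : b ∈ B := Finset.mem_sdiff.2 ⟨hb, hbA⟩
  have hd : Disjoint A B := Finset.disjoint_sdiff
  have hU : A ∪ B = W := Finset.union_sdiff_of_subset hA
  clear_value B
  subst hU
  have hab : ∀ x ∈ A, ∀ y ∈ B, G.Adj x y → x = a ∧ y = b := by
    intro x hx y hy hxy
    have hyA := Finset.disjoint_right.1 hd hy
    rcases adj_of_deleteEdge hxy (hcross x hx y (Finset.mem_union_right _ hy) hyA) with h | h
    · exact h
    · exact absurd (h.1 ▸ hx) hbA
  have hle : G.deleteEdges {s(a, b)} ≤ G := SimpleGraph.deleteEdges_le _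
  have hsum : stabilityOn G A + stabilityOn G B = k + 1 := by
    refine le_antisymm ?_ (hs ▸ stabilityOn_union_le A B)
    refine (add_le_add (stabilityOn_anti hle) (stabilityOn_anti hle)).trans
      ((stabilityOn_union hd fun x hx y hy => hcross x hx y (Finset.mem_union_right _ hy)
        (Finset.disjoint_right.1 hd hy)).trans (hs ▸ hsafe))
  have hAc : 0 < A.card := Finset.card_pos.2 ⟨a, ha⟩
  have hBc : 0 < B.card := Finset.card_pos.2 ⟨b, hbB⟩
  have hAs := stabilityOn_pos (G := G) (Finset.card_pos.1 hAc)
  have hBs := stabilityOn_pos (G := G) (Finset.card_pos.1 hBc)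
  have hABc := Finset.card_union_of_disjoint hd
  obtain ⟨m₁, hm₁⟩ := Nat.exists_eq_add_of_le' hAc
  obtain ⟨m₂, hm₂⟩ := Nat.exists_eq_add_of_le' hBc
  obtain ⟨b₁, hb₁⟩ := Nat.exists_eq_add_of_le' hAs
  obtain ⟨b₂, hb₂⟩ := Nat.exists_eq_add_of_le' hBs
  simp only [Nat.zero_add, Nat.succ_eq_add_one] at *
  obtain rfl : m = m₁ + m₂ + 1 := by omega
  obtain rfl : k = b₁ + b₂ + 1 := by omega
  have hba : ∀ x ∈ B, ∀ y ∈ A, G.Adj x y → x = b ∧ y = a :=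
    fun x hx y hy hxy => (hab y hy x hx hxy.symm).symm
  have hfA := IH A (by omega) (hW.of_bridge ha hab) m₁ b₁ hm₁ hb₁
  have hfB := IH B (by omega)
    (IsConnectedOn.of_bridge (Finset.union_comm A B ▸ hW) hbB hba) m₂ b₂ hm₂ hb₂
  rcases le_total (m₂ / (b₂ + 1)) (m₁ / (b₁ + 1)) with hk | hk
  · exact join_bound hd ha hbB hadj hab hm₁ hm₂ hb₁ hb₂ hfA hfB hk
  · have := join_bound hd.symm hbB ha hadj.symm hba hm₂ hm₁ hb₂ hb₁ hfB hfA hk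
    rwa [Finset.union_comm, add_comm m₂, add_comm b₂] at this

/-- The cases are α = 1, a critical graph, and an edge whose deletion keeps α; the last splits
according to whether the deletion keeps W connected. The induction hypotheses contain only the
inequality, because equality is analysed afresh at each step. -/
theorem connected_bound_step (hW : IsConnectedOn G W)
    (IH : ∀ U : Finset V, U.card < W.card → SatisfiesBound G U)
    (IH' : ∀ H : SimpleGraph V, H < G → SatisfiesBound H W) {m b : ℕ}
    (hcard : W.card = m + 1) (hs : stabilityOn G W = b + 1) :
    stableCount G W ≤ turanConnectedCount m b ∧
    (stableCount G W = turanConnectedCount m b →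
      (∃ v ∈ W, IsHub G W m b v) ∨ b = 1 ∧ IsPentagonOn G W) := by
  rcases Nat.eq_zero_or_pos b with rfl | hb
  · exact (bound_of_stabilityOn_eq_one hcard hs).imp_right fun h heq => Or.inl (h heq)
  by_cases hcr : IsStabilityCriticalOn G W
  · exact (critical_bound hW hcr IH hb hcard hs).imp_right fun h heq => Or.inr (h heq)
  unfold IsStabilityCriticalOn at hcr
  push Not at hcr
  obtain ⟨u, hu, w, hw, huw, hsafe⟩ := hcr
  -- A stable set of the smaller graph exceeding α would contain both u and w, and uw would be its
  -- only edge in G, which `hsafe` excludes.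
  have hsafe' : stabilityOn (G.deleteEdges {s(u, w)}) W ≤ stabilityOn G W := by
    obtain ⟨s, hss, hsc⟩ := exists_card_eq_stabilityOn (G.deleteEdges {s(u, w)}) W
    rw [mem_stableSets] at hss
    by_contra! hlt
    have husw : u ∈ s ∧ w ∈ s := by
      by_contra hn
      refine absurd (card_le_stabilityOn (G := G) (W := W) (s := s)
        (mem_stableSets.2 ⟨hss.1, fun x hx y hy hxy => ?_⟩)) (by omega)
      rcases adj_of_deleteEdge hxy (hss.2 x hx y hy) with h | h
      · exact hn ⟨h.1 ▸ hx, h.2 ▸ hy⟩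
      · exact hn ⟨h.2 ▸ hy, h.1 ▸ hx⟩
    obtain ⟨x, hx, y, hy, hxy, h1, h2⟩ := hsafe s hss.1 husw.1 husw.2 (by omega)
    rcases adj_of_deleteEdge hxy (hss.2 x hx y hy) with h | h
    · exact h1 h.1 h.2
    · exact h2 h.1 h.2
  have hle : G.deleteEdges {s(u, w)} ≤ G := SimpleGraph.deleteEdges_le _
  have hnadj : ¬(G.deleteEdges {s(u, w)}).Adj u w := by simp [SimpleGraph.deleteEdges_adj]
  by_cases hconn : IsConnectedOn (G.deleteEdges {s(u, w)}) W
  · have h1 := stableCount_lt_of_le hle hu hw huw hnadj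
    have h2 := IH' _ (lt_of_le_of_ne hle fun h => hnadj (h.symm ▸ huw)) hconn m b hcard
      (hs ▸ le_antisymm hsafe' (stabilityOn_anti hle))
    exact ⟨by omega, fun h => by omega⟩
  · unfold IsConnectedOn at hconn
    push Not at hconn
    obtain ⟨A, hA, hAne, hAW, hcross⟩ := hconn hW.1
    obtain ⟨x, hx, y, hy, hyA, hxy⟩ := hW.2 A hA hAne hAW
    have key : stableCount G W ≤ turanConnectedCount m b ∧
        (stableCount G W = turanConnectedCount m b → ∃ v ∈ W, IsHub G W m b v) := by
      rcases adj_of_deleteEdge hxy (hcross x hx y hy hyA) with ⟨rfl, rfl⟩ | ⟨rfl, rfl⟩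
      · exact bridge_bound hW IH hA hx hy hyA hxy hcross hsafe' hcard hs
      · rw [Sym2.eq_swap] at hcross hsafe'
        exact bridge_bound hW IH hA hx hy hyA hxy hcross hsafe' hcard hs
    exact key.imp_right fun h heq => Or.inl (h heq)

theorem satisfiesBound [Finite V] (G : SimpleGraph V) (W : Finset V) : SatisfiesBound G W := by
  induction hn : W.card using Nat.strong_induction_on generalizing W G with
  | _ n ih =>
  subst hn
  induction G using WellFoundedLT.induction with
  | _ G ihG =>
  intro hW m b hcard hs
  exact (connected_bound_step hW (fun U hU => ih _ hU G U rfl) ihG hcard hs).1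

/-- The bound for connected graphs together with its extremal graphs. -/
theorem connected_bound [Finite V] (hW : IsConnectedOn G W) {m b : ℕ}
    (hcard : W.card = m + 1) (hs : stabilityOn G W = b + 1) :
    stableCount G W ≤ turanConnectedCount m b ∧
    (stableCount G W = turanConnectedCount m b →
      (∃ v ∈ W, IsHub G W m b v) ∨ b = 1 ∧ IsPentagonOn G W) :=
  connected_bound_step hW (fun U _ => satisfiesBound G U) (fun H _ => satisfiesBound H W) hcard hs

end Critical

end Extremal

/-! ### From hub counts to the Turán-connected graph -/

section CliqueStar

variable {V V' ι : Type*}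

/-- The classes of `c` are cliques, and the only edges between different classes join the hub
`r h` to the representatives `r i` of the other classes. -/
structure IsCliqueStar (G : SimpleGraph V) (c : V → ι) (r : ι → V) (h : ι) : Prop where
  color_rep : ∀ i, c (r i) = i
  adj_iff : ∀ x y, x ≠ y →
    (G.Adj x y ↔ c x = c y ∨ (x = r h ∧ y = r (c y)) ∨ (y = r h ∧ x = r (c x)))

/-- The class of the hub has order `q + 1`, the other ones have order `q` or `q + 1`. -/
def HasStarSizes [Fintype V] [DecidableEq ι] (c : V → ι) (h : ι) (q : ℕ) : Prop :=
  (Finset.univ.filter fun x => c x = h).card = q + 1 ∧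
    ∀ i, (Finset.univ.filter fun x => c x = i).card = q ∨
      (Finset.univ.filter fun x => c x = i).card = q + 1

theorem sum_of_two_values {J : Finset ι} {s : ι → ℕ} {q : ℕ}
    (h : ∀ j ∈ J, s j = q ∨ s j = q + 1) :
    ∑ j ∈ J, s j = q * J.card + (J.filter fun j => s j = q + 1).card := by
  rw [Finset.card_filter, mul_comm, ← smul_eq_mul, ← Finset.sum_const, ← Finset.sum_add_distrib]
  refine Finset.sum_congr rfl fun j hj => ?_
  rcases h j hj with h | h <;> simp [h]

theorem prod_of_two_values {J : Finset ι} {s : ι → ℕ} {q t : ℕ}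
    (h : ∀ j ∈ J, s j = q ∨ s j = q + 1) (hs : ∑ j ∈ J, s j = q * J.card + t) (f : ℕ → ℕ) :
    ∏ j ∈ J, f (s j) = f q ^ (J.card - t) * f (q + 1) ^ t := by
  rw [sum_of_two_values h] at hs
  have ht : (J.filter fun j => s j = q + 1).card = t := by omega
  have h1 := Finset.card_filter_add_card_filter_not (s := J) (fun j => s j = q + 1)
  rw [← Finset.prod_filter_mul_prod_filter_not J (fun j => s j = q + 1),
    Finset.prod_congr rfl (g := fun _ => f (q + 1)), Finset.prod_const, ht,
    Finset.prod_congr rfl (g := fun _ => f q), Finset.prod_const, mul_comm]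
  · congr 2
    omega
  · intro j hj
    rw [Finset.mem_filter] at hj
    rw [(h j hj.1).resolve_right hj.2]
  · intro j hj
    rw [(Finset.mem_filter.1 hj).2]

theorem exists_perm_of_two_values [Fintype ι] {s t : ι → ℕ} {q : ℕ} {h h' : ι}
    (hs : ∀ i, s i = q ∨ s i = q + 1) (ht : ∀ i, t i = q ∨ t i = q + 1) (hsh : s h = q + 1)
    (hth : t h' = q + 1) (hsum : ∑ i, s i = ∑ i, t i) :
    ∃ σ : Equiv.Perm ι, σ h = h' ∧ ∀ i, s i = t (σ i) := by
  classical
  rw [sum_of_two_values fun j _ => hs j, sum_of_two_values fun j _ => ht j] at hsum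
  have e : {i // s i = q + 1} ≃ {i // t i = q + 1} := Fintype.equivOfCardEq (by
    rw [Fintype.card_subtype, Fintype.card_subtype]
    omega)
  have key : ∀ i, s i = t (e.extendSubtype i) := by
    intro i
    by_cases hi : s i = q + 1
    · rw [hi, e.extendSubtype_mem i hi]
    · rw [(hs i).resolve_right hi, ((ht _).resolve_right (e.extendSubtype_not_mem i hi))]
  -- The swap sends h to h'; it exchanges two classes of order q + 1, so orders are still preserved.
  refine ⟨e.extendSubtype.trans (Equiv.swap (e.extendSubtype h) h'), by simp, fun i => ?_⟩
  rw [key, Equiv.trans_apply]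
  by_cases h1 : e.extendSubtype i = e.extendSubtype h
  · rw [h1, Equiv.swap_apply_left, hth, ← key, hsh]
  · by_cases h2 : e.extendSubtype i = h'
    · rw [h2, Equiv.swap_apply_right, hth, ← key, hsh]
    · rw [Equiv.swap_apply_of_ne_of_ne h1 h2]

/-- Bijections of corresponding classes are corrected by a transposition in each class to match the
representatives, then glued. -/
theorem exists_equiv_of_colorings [Fintype V] [Fintype V'] [DecidableEq ι] {c : V → ι}
    {c' : V' → ι} {r : ι → V} {r' : ι → V'} (hr : ∀ i, c (r i) = i) (hr' : ∀ i, c' (r' i) = i)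
    (σ : Equiv.Perm ι) (hσ : ∀ i, (Finset.univ.filter fun x => c x = i).card =
      (Finset.univ.filter fun x => c' x = σ i).card) :
    ∃ e : V ≃ V', (∀ x, c' (e x) = σ (c x)) ∧ ∀ i, e (r i) = r' (σ i) := by
  classical
  have hf : ∀ i, ∃ f : {x // c x = i} ≃ {y // c' y = σ i},
      f ⟨r i, hr i⟩ = ⟨r' (σ i), hr' (σ i)⟩ := by
    intro i
    have f : {x // c x = i} ≃ {y // c' y = σ i} := Fintype.equivOfCardEq (by
      rw [Fintype.card_subtype, Fintype.card_subtype]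
      exact hσ i)
    exact ⟨f.trans (Equiv.swap (f ⟨r i, hr i⟩) ⟨r' (σ i), hr' (σ i)⟩), by simp⟩
  choose f hf using hf
  set e := (Equiv.sigmaFiberEquiv c).symm.trans
    ((Equiv.sigmaCongr σ f).trans (Equiv.sigmaFiberEquiv c')) with he
  have key : ∀ i x (hx : c x = i), e x = f i ⟨x, hx⟩ := by
    rintro _ x rfl
    rfl
  refine ⟨e, fun x => ?_, fun i => ?_⟩
  · rw [key _ x rfl]
    exact (f (c x) ⟨x, rfl⟩).2
  · rw [key i (r i) (hr i), hf]

namespace IsCliqueStar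

variable {G : SimpleGraph V} {G' : SimpleGraph V'} {c : V → ι} {r : ι → V} {h : ι}
  {c' : V' → ι} {r' : ι → V'} {h' : ι}

theorem nonempty_iso [Fintype V] [Fintype V'] [Fintype ι] [DecidableEq ι] {q : ℕ}
    (hG : IsCliqueStar G c r h) (hG' : IsCliqueStar G' c' r' h') (hc : HasStarSizes c h q)
    (hc' : HasStarSizes c' h' q) (hcard : Fintype.card V = Fintype.card V') :
    Nonempty (G ≃g G') := by
  obtain ⟨σ, hσ, hs⟩ := exists_perm_of_two_values hc.2 hc'.2 hc.1 hc'.1 (by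
    rw [← Finset.card_eq_sum_card_fiberwise fun _ _ => Finset.mem_coe.2 (Finset.mem_univ _),
      ← Finset.card_eq_sum_card_fiberwise fun _ _ => Finset.mem_coe.2 (Finset.mem_univ _)]
    exact hcard)
  obtain ⟨e, he, her⟩ := exists_equiv_of_colorings hG.color_rep hG'.color_rep σ hs
  refine ⟨⟨e, fun {x y} => ?_⟩⟩
  rcases eq_or_ne x y with rfl | hxy
  · simp
  · rw [hG.adj_iff x y hxy, hG'.adj_iff _ _ (e.injective.ne hxy), he, he, σ.apply_eq_iff_eq,
      ← her, ← her, ← hσ, ← her, e.apply_eq_iff_eq, e.apply_eq_iff_eq, e.apply_eq_iff_eq,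
      e.apply_eq_iff_eq]

theorem stableCount_eq [Fintype V] [Fintype ι] [DecidableEq ι] {m b : ℕ}
    (hG : IsCliqueStar G c r h) (hc : HasStarSizes c h (m / (b + 1)))
    (hV : Fintype.card V = m + 1) (hι : Fintype.card ι = b + 1) :
    stableCount G Finset.univ = turanConnectedCount m b := by
  classical
  set s : ι → ℕ := fun i => (Finset.univ.filter fun x => c x = i).card with hs
  have hsum : ∑ i, s i = m + 1 := by
    rw [← hV, ← Finset.card_univ, Finset.card_eq_sum_card_fiberwise (f := c) (t := Finset.univ)
      fun _ _ => Finset.mem_coe.2 (Finset.mem_univ _)]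
  have hmod : m = m / (b + 1) * (b + 1) + m % (b + 1) := (Nat.div_add_mod' _ _).symm
  have htb : m % (b + 1) ≤ b := Nat.lt_succ_iff.1 (Nat.mod_lt _ (by omega))
  have hhub : ∀ x y, x ≠ r h → y ≠ r h → x ≠ y → (G.Adj x y ↔ c x = c y) := by
    intro x y hx hy hxy
    rw [hG.adj_iff x y hxy]
    simp [hx, hy]
  have herest : ∑ i ∈ Finset.univ.erase h, s i = m - m / (b + 1) := by
    have := Finset.add_sum_erase Finset.univ s (Finset.mem_univ h)
    have h1 : s h = m / (b + 1) + 1 := hc.1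
    generalize m / (b + 1) = q at *
    omega
  have hcarde : (Finset.univ.erase h : Finset ι).card = b := by
    rw [Finset.card_erase_of_mem (Finset.mem_univ h), Finset.card_univ, hι]; rfl
  have hcross : ∑ i ∈ Finset.univ.erase h, s i =
      m / (b + 1) * (Finset.univ.erase h : Finset ι).card + m % (b + 1) := by
    rw [herest, hcarde]
    rw [mul_add, mul_one] at hmod
    generalize m / (b + 1) * b = z at *
    omega
  have hprod : ∀ f : ℕ → ℕ, ∏ i ∈ Finset.univ.erase h, f (s i) =
      f (m / (b + 1)) ^ (b - m % (b + 1)) * f (m / (b + 1) + 1) ^ (m % (b + 1)) := fun f => by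
    rw [prod_of_two_values (fun i _ => hc.2 i) hcross f, hcarde]
  rw [stableCount_eq_erase_add (Finset.mem_univ (r h)), turanConnectedCount]
  congr 1
  · have hcol : IsCliqueColoring G (Finset.univ.erase (r h)) c Finset.univ :=
      ⟨fun _ _ => Finset.mem_univ _, fun x hx y hy => hhub x y (Finset.ne_of_mem_erase hx)
        (Finset.ne_of_mem_erase hy)⟩
    have e1 : ((Finset.univ.erase (r h)).filter fun x => c x = h).card = m / (b + 1) := by
      rw [Finset.filter_erase, Finset.card_erase_of_mem (by simp [hG.color_rep])]
      exact congrArg (· - 1) hc.1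
    have e2 : ∀ i ∈ Finset.univ.erase h,
        ((Finset.univ.erase (r h)).filter fun x => c x = i).card + 1 = s i + 1 := by
      intro i hi
      rw [Finset.filter_erase, Finset.erase_eq_of_notMem]
      simpa [hG.color_rep] using (Finset.ne_of_mem_erase hi).symm
    convert hcol.stableCount_eq using 1
    rw [← Finset.mul_prod_erase _ _ (Finset.mem_univ h), Finset.prod_congr rfl e2,
      hprod (fun x => x + 1), e1]
    nth_rewrite 1 [hmod]
    rw [turanCount_eq _ _ _ (by omega), show b + 1 - m % (b + 1) = b - m % (b + 1) + 1 by omega]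
    ring
  · have hne : ∀ x ∈ awayFrom G Finset.univ (r h), x ≠ r h ∧ c x ≠ h ∧ x ≠ r (c x) := by
      intro x hx
      obtain ⟨-, hx1, hx2⟩ := mem_awayFrom.1 hx
      rw [hG.adj_iff _ _ hx1.symm, hG.color_rep] at hx2
      push Not at hx2
      exact ⟨hx1, hx2.1.symm, hx2.2.1 rfl⟩
    have hcol : IsCliqueColoring G (awayFrom G Finset.univ (r h)) c (Finset.univ.erase h) :=
      ⟨fun x hx => Finset.mem_erase.2 ⟨(hne x hx).2.1, Finset.mem_univ _⟩,
        fun x hx y hy => hhub x y (hne x hx).1 (hne y hy).1⟩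
    -- Each class other than the hub's loses only its representative, so the factor order + 1 is the
    -- original order.
    have e2 : ∀ i ∈ Finset.univ.erase h,
        ((awayFrom G Finset.univ (r h)).filter fun x => c x = i).card + 1 = s i := by
      intro i hi
      have hi' := Finset.ne_of_mem_erase hi
      rw [show (awayFrom G Finset.univ (r h)).filter (fun x => c x = i) =
        (Finset.univ.filter fun x => c x = i).erase (r i) from ?_,
        Finset.card_erase_add_one (by simp [hG.color_rep])]
      ext x
      simp only [Finset.mem_filter, Finset.mem_erase, Finset.mem_univ, true_and]
      constructor
      · rintro ⟨hx, rfl⟩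
        exact ⟨(hne x hx).2.2, rfl⟩
      · rintro ⟨hx, rfl⟩
        refine ⟨mem_awayFrom.2 ⟨Finset.mem_univ _, ?_, ?_⟩, rfl⟩
        · rintro rfl
          exact hi' (hG.color_rep h)
        · intro hadj
          rw [hG.adj_iff _ _ hadj.ne, hG.color_rep] at hadj
          rcases hadj with hh | ⟨-, hh⟩ | ⟨hh, -⟩
          · exact hi' hh.symm
          · exact hx hh
          · exact hi' (by rw [hh, hG.color_rep])
    rw [hcol.stableCount_eq, Finset.prod_congr rfl e2, hprod (fun x => x), hubCount]

end IsCliqueStar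

/-- The hub condition forces the structure of a balanced star of cliques. -/
theorem exists_isCliqueStar [Fintype V] [DecidableEq V] {G : SimpleGraph V} {m b : ℕ} {v : V}
    (hconn : IsConnectedOn G Finset.univ) (hcard : Fintype.card V = m + 1)
    (hs : stabilityOn G Finset.univ = b + 1) (hv : IsHub G Finset.univ m b v) :
    ∃ (c : V → Fin (b + 1)) (r : Fin (b + 1) → V) (h : Fin (b + 1)),
      IsCliqueStar G c r h ∧ HasStarSizes c h (m / (b + 1)) := by
  set E : Finset V := Finset.univ.erase v with hE
  have hmemE : ∀ x, x ∈ E ↔ x ≠ v := fun x => by simp [hE]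
  have hEcard : E.card = m := by
    rw [hE, Finset.card_erase_of_mem (Finset.mem_univ v), Finset.card_univ, hcard]; rfl
  have hEs : stabilityOn G E ≤ b + 1 := hs ▸ stabilityOn_mono (Finset.subset_univ _)
  obtain ⟨c, hc⟩ := exists_isCliqueColoring hEs (by rw [hEcard]; exact hv.1)
  obtain ⟨i, hi, hadj⟩ := exists_adj_class (Finset.mem_univ v) hs.le hc
  have hsum := hc.sum_card
  rw [hEcard] at hsum
  have hbal : ∀ j ∈ Finset.range (b + 1), ∀ k ∈ Finset.range (b + 1),
      (E.filter fun x => c x = j).card ≤ (E.filter fun x => c x = k).card + 1 :=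
    fun j hj k hk => hc.balanced (by rw [hEcard, Finset.card_range]; exact hv.1) hj hk
  have hlow : ∀ j ∈ Finset.range (b + 1), m / (b + 1) ≤ (E.filter fun x => c x = j).card :=
    fun j hj => div_le_of_balanced (s := fun j => (E.filter fun x => c x = j).card) hsum (by simp)
      hj fun k hk => hbal k hk j hj
  have hhigh : ∀ j ∈ Finset.range (b + 1), (E.filter fun x => c x = j).card ≤ m / (b + 1) + 1 :=
    fun j hj => le_div_succ_of_balanced (s := fun j => (E.filter fun x => c x = j).card) hsum
      (by simp) fun k hk => hbal j hj k hk
  have hbm : b ≤ m := by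
    have := stabilityOn_le_card (G := G) (W := Finset.univ)
    rw [Finset.card_univ] at this
    omega
  -- Classes are cliques with no edges between them, so by connectivity each one has an edge to v;
  -- for class i this is already known.
  have hrep : ∀ j ∈ (Finset.range (b + 1)).erase i, ∃ x ∈ E, c x = j ∧ G.Adj v x := by
    intro j hj
    have hj' := Finset.mem_of_mem_erase hj
    have hb : 1 ≤ b := by
      have := Finset.ne_of_mem_erase hj
      rw [Finset.mem_range] at hj' hi
      omega
    have hlt := hconn.stabilityOn_lt_card (by rw [Finset.card_univ]; omega)
    rw [Finset.card_univ, hs, hcard] at hlt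
    have hq : 0 < m / (b + 1) := Nat.div_pos (by omega) (by omega)
    obtain ⟨x, hx, y, -, hy, hxy⟩ := hconn.2 (E.filter fun x => c x = j) (Finset.subset_univ _)
      (Finset.card_pos.1 (hq.trans_le (hlow j hj'))) (fun h => by
        have : v ∈ E.filter fun x => c x = j := by rw [h]; exact Finset.mem_univ _
        exact (hmemE v).1 (Finset.mem_filter.1 this).1 rfl)
    rw [Finset.mem_filter] at hx hy
    refine ⟨x, hx.1, hx.2, ?_⟩
    by_cases hyv : y = v
    · exact hyv ▸ hxy.symm
    · have hyE := (hmemE y).2 hyv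
      exact absurd ⟨hyE, ((hc.adj_iff x hx.1 y hyE hxy.ne).1 hxy).symm.trans hx.2⟩ hy
  have : Nonempty V := ⟨v⟩
  choose! r hrE hrc hrv using hrep
  set Y := E.filter fun x => c x ≠ i with hY
  set R := ((Finset.range (b + 1)).erase i).image r with hR
  have hRY : R ⊆ Y := by
    intro x hx
    obtain ⟨j, hj, rfl⟩ := Finset.mem_image.1 hx
    exact Finset.mem_filter.2 ⟨hrE j hj, by rw [hrc j hj]; exact Finset.ne_of_mem_erase hj⟩
  have hRcard : R.card = b := by
    rw [hR, Finset.card_image_of_injOn, Finset.card_erase_of_mem hi, Finset.card_range]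
    · rfl
    · intro j hj k hk hjk
      rw [← hrc j hj, ← hrc k hk, hjk]
  have hYcard : (E.filter fun x => c x = i).card + Y.card = m := by
    rw [← hEcard]; exact Finset.card_filter_add_card_filter_not (s := E) (fun x => c x = i)
  have hXcard := Finset.card_sdiff_add_card_eq_card hRY
  -- Besides class i, at least one representative of each other class is adjacent to v. The hub
  -- count shows below that v has no further neighbours.
  have hsub : awayFrom G Finset.univ v ⊆ Y \ R := by
    intro x hx
    obtain ⟨-, hx1, hx2⟩ := mem_awayFrom.1 hx
    rw [Finset.mem_sdiff, hY, Finset.mem_filter, hmemE]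
    refine ⟨⟨hx1, fun h => hx2 (hadj x ((hmemE x).2 hx1) h)⟩, fun h => ?_⟩
    obtain ⟨j, hj, rfl⟩ := Finset.mem_image.1 h
    exact hx2 (hrv j hj)
  have hYs : stabilityOn G (Y \ R) ≤ b := by
    refine (stabilityOn_mono Finset.sdiff_subset).trans ((hc.erase i).stabilityOn_le_card.trans ?_)
    rw [Finset.card_erase_of_mem hi, Finset.card_range]; rfl
  have hX := stableCount_le_turanCount hYs
  have hmono := stableCount_mono (G := G) hsub
  have hhub := hv.2
  rw [hubCount_eq_turanCount hbm] at hhub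
  have hlowi := hlow i hi
  have hdiv := div_add_le hbm
  have hXle : turanCount (Y \ R).card b ≤ turanCount (m - m / (b + 1) - b) b := by
    apply turanCount_mono
    generalize m / (b + 1) = q at *
    omega
  have hXeq : awayFrom G Finset.univ v = Y \ R :=
    eq_of_stableCount_eq (G := G) hsub (le_antisymm hmono (by omega))
  have hsi : (E.filter fun x => c x = i).card = m / (b + 1) := by
    -- `turanCount` with no cliques is constant, so strict monotonicity fixes the order of class i
    -- only when there is another class; with a single class the total is its order.
    rcases b with _ | b
    · have : i = 0 := by simpa using hi
      subst this
      simpa using hsum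
    · refine le_antisymm ?_ hlowi
      have := (turanCount_strictMono b).le_iff_le.1
        (show turanCount (m - m / (b + 1 + 1) - (b + 1)) (b + 1) ≤
          turanCount (Y \ R).card (b + 1) by omega)
      generalize m / (b + 1 + 1) = q at *
      omega
  have hvadj : ∀ y, y ≠ v → (G.Adj v y ↔ c y = i ∨ y = r (c y) ∧ c y ≠ i) := by
    intro y hy
    have hyE := (hmemE y).2 hy
    have h1 : y ∈ awayFrom G Finset.univ v ↔ ¬G.Adj v y := by
      rw [mem_awayFrom]; simp [hy]
    have h2 : y ∈ R ↔ y = r (c y) ∧ c y ≠ i := by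
      rw [hR, Finset.mem_image]
      constructor
      · rintro ⟨j, hj, rfl⟩
        rw [hrc j hj]
        exact ⟨rfl, Finset.ne_of_mem_erase hj⟩
      · rintro ⟨h, h'⟩
        exact ⟨c y, Finset.mem_erase.2 ⟨h', hc.mem y hyE⟩, h.symm⟩
    rw [hXeq, Finset.mem_sdiff, hY, Finset.mem_filter, h2] at h1
    simp only [hyE, true_and] at h1
    tauto
  have hi' := Finset.mem_range.1 hi
  -- The vertex v joins class i, which it dominates, and becomes its representative.
  set c' : V → ℕ := Function.update c v i with hc'
  have hc'v : c' v = i := Function.update_self ..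
  have hc'ne : ∀ x, x ≠ v → c' x = c x := fun x hx => Function.update_of_ne hx ..
  have hc'lt : ∀ x, c' x < b + 1 := by
    intro x
    by_cases hx : x = v
    · rw [hx, hc'v]; exact hi'
    · rw [hc'ne x hx]; exact Finset.mem_range.1 (hc.mem x ((hmemE x).2 hx))
  set r' : ℕ → V := Function.update r i v with hr'
  have hr'i : r' i = v := Function.update_self ..
  have hr'ne : ∀ j, j ≠ i → r' j = r j := fun j hj => Function.update_of_ne hj ..
  refine ⟨fun x => ⟨c' x, hc'lt x⟩, fun j => r' j, ⟨i, hi'⟩, ⟨fun j => ?_, ?_⟩, ?_, fun j => ?_⟩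
  · apply Fin.ext
    change c' (r' j) = j
    by_cases hj : (j : ℕ) = i
    · rw [hj, hr'i, hc'v]
    · have hj' : (j : ℕ) ∈ (Finset.range (b + 1)).erase i :=
        Finset.mem_erase.2 ⟨hj, Finset.mem_range.2 j.2⟩
      rw [hr'ne _ hj, hc'ne _ ((hmemE _).1 (hrE _ hj')), hrc _ hj']
  · have hhalf : ∀ y, y ≠ v → (G.Adj v y ↔ i = c' y ∨ y = r' (c' y)) := by
      intro y hy
      rw [hvadj y hy, hc'ne y hy]
      by_cases hyi : c y = i
      · simp [hyi]
      · rw [hr'ne _ hyi]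
        simp [hyi, Ne.symm hyi]
    intro x y hxy
    simp only [Fin.mk.injEq]
    rw [hr'i]
    rcases eq_or_ne x v with rfl | hx
    · rw [hhalf y hxy.symm, hc'v]
      simp [hxy.symm]
    · rcases eq_or_ne y v with rfl | hy
      · rw [G.adj_comm, hhalf x hxy, hc'v]
        simp [hxy, eq_comm]
      · rw [hc'ne x hx, hc'ne y hy, hc.adj_iff x ((hmemE x).2 hx) y ((hmemE y).2 hy) hxy]
        simp [hx, hy]
  · rw [← hsi, ← Finset.card_insert_of_notMem
      (show v ∉ E.filter fun x => c x = i by simp [hE])]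
    congr 1
    ext x
    simp only [Fin.mk.injEq, Finset.mem_filter, Finset.mem_univ, true_and, Finset.mem_insert, hmemE]
    by_cases hx : x = v
    · simp [hx, hc'v]
    · simp [hx, hc'ne x hx]
  · by_cases hj : (j : ℕ) = i
    · right
      rw [← hsi, ← Finset.card_insert_of_notMem
        (show v ∉ E.filter fun x => c x = i by simp [hE])]
      congr 1
      ext x
      simp only [Fin.ext_iff, hj, Finset.mem_filter, Finset.mem_univ, true_and, Finset.mem_insert,
        hmemE]
      by_cases hx : x = v
      · simp [hx, hc'v]
      · simp [hx, hc'ne x hx]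
    · have hjr : (j : ℕ) ∈ Finset.range (b + 1) := Finset.mem_range.2 j.2
      have e : (Finset.univ.filter fun x => (⟨c' x, hc'lt x⟩ : Fin (b + 1)) = j) =
          E.filter fun x => c x = j := by
        ext x
        simp only [Fin.ext_iff, Finset.mem_filter, Finset.mem_univ, true_and, hmemE]
        by_cases hx : x = v
        · simp [hx, hc'v, Ne.symm hj]
        · simp [hx, hc'ne x hx]
      rw [e]
      have h1 := hlow j hjr
      have h2 := hhigh j hjr
      generalize m / (b + 1) = q at *
      omega

end CliqueStar

/-! ### Translation to the graphs of the theorem -/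

theorem fibonacciIndex_eq_stableCount {V : Type*} [Fintype V] (G : SimpleGraph V) :
    fibonacciIndex G = stableCount G Finset.univ := by
  classical
  rw [fibonacciIndex, Nat.card_eq_fintype_card, Fintype.card_subtype, stableCount, stableSets]
  congr 1

theorem fibonacciIndex_congr {V V' : Type*} {G : SimpleGraph V} {G' : SimpleGraph V'}
    (e : G ≃g G') : fibonacciIndex G = fibonacciIndex G' := by
  refine Nat.card_congr (e.toEquiv.finsetCongr.subtypeEquiv fun s => ?_)
  simp only [SimpleGraph.IsIndepSet, Equiv.finsetCongr_apply, Finset.coe_map, Set.Pairwise,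
    Set.mem_image, Finset.mem_coe]
  constructor
  · rintro h _ ⟨x, hx, rfl⟩ _ ⟨y, hy, rfl⟩ hxy hadj
    exact h hx hy (fun h => hxy (by rw [h])) (e.map_adj_iff.1 hadj)
  · intro h x hx y hy hxy hadj
    exact h ⟨x, hx, rfl⟩ ⟨y, hy, rfl⟩ (fun h => hxy (e.injective h)) (e.map_adj_iff.2 hadj)

theorem indepNum_eq_stabilityOn {V : Type*} [Fintype V] (G : SimpleGraph V) :
    G.indepNum = stabilityOn G Finset.univ := by
  classical
  apply le_antisymm
  · obtain ⟨s, hs⟩ := G.exists_isNIndepSet_indepNum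
    rw [← hs.card_eq]
    exact card_le_stabilityOn (Finset.mem_filter.2 ⟨by simp, hs.isIndepSet⟩)
  · refine stabilityOn_le fun s hs => ?_
    exact SimpleGraph.IsIndepSet.card_le_indepNum (Finset.mem_filter.1 hs).2

theorem SimpleGraph.Connected.isConnectedOn {V : Type*} [Fintype V] {G : SimpleGraph V}
    (h : G.Connected) : IsConnectedOn G Finset.univ := by
  obtain ⟨v⟩ := h.nonempty
  refine ⟨⟨v, Finset.mem_univ v⟩, fun A _ ⟨a, ha⟩ hAne => ?_⟩
  obtain ⟨b, hb⟩ : ∃ b, b ∉ A := by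
    by_contra! hall
    exact hAne (Finset.eq_univ_iff_forall.2 hall)
  obtain ⟨p⟩ := h.preconnected a b
  obtain ⟨d, -, hd1, hd2⟩ := p.exists_boundary_dart (A : Set V) ha hb
  exact ⟨d.fst, hd1, d.snd, Finset.mem_univ _, hd2, d.adj⟩

theorem IsPentagonOn.nonempty_iso {V : Type*} [Fintype V] {G : SimpleGraph V}
    (h : IsPentagonOn G Finset.univ) : Nonempty (G ≃g SimpleGraph.cycleGraph 5) := by
  obtain ⟨p, hp, hsurj, hadj⟩ := h
  have hbij : Function.Bijective p := ⟨hp, fun w => (hsurj w).1 (Finset.mem_univ w)⟩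
  refine ⟨SimpleGraph.Iso.symm ⟨Equiv.ofBijective p hbij, fun {i j} => ?_⟩⟩
  rw [Equiv.ofBijective_apply, Equiv.ofBijective_apply, hadj, SimpleGraph.cycleGraph_adj,
    sub_eq_iff_eq_add', sub_eq_iff_eq_add', or_comm]

theorem isCliqueStar_turanConnected {n b : ℕ} (h : b + 1 ≤ n) :
    IsCliqueStar (turanConnected n (b + 1))
      (fun x => (⟨(x : ℕ) % (b + 1), Nat.mod_lt _ (Nat.succ_pos b)⟩ : Fin (b + 1)))
      (fun i => Fin.castLE h i) 0 := by
  refine ⟨fun i => Fin.ext (Nat.mod_eq_of_lt i.2), fun x y hxy => ?_⟩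
  -- The representatives of the residue classes are the vertices 0, …, b.
  have key : ∀ z : Fin n, (z : ℕ) < b + 1 ↔
      z = Fin.castLE h ⟨(z : ℕ) % (b + 1), Nat.mod_lt _ (Nat.succ_pos b)⟩ := by
    intro z
    rw [Fin.ext_iff, Fin.val_castLE]
    constructor
    · intro hz
      exact (Nat.mod_eq_of_lt hz).symm
    · intro hz
      rw [hz]
      exact Nat.mod_lt _ (Nat.succ_pos b)
  have key0 : ∀ z : Fin n, (z : ℕ) = 0 ↔ z = Fin.castLE h 0 := fun z => by
    rw [Fin.ext_iff]; rfl
  rw [turanConnected, SimpleGraph.sup_adj, SimpleGraph.fromRel_adj, turanCliques,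
    SimpleGraph.compl_adj, SimpleGraph.turanGraph_adj, not_not, ← key, ← key, ← key0, ← key0,
    Fin.mk.injEq]
  tauto

theorem card_filter_mod_eq {n b i : ℕ} (hi : i < b + 1) :
    (Finset.univ.filter fun x : Fin n => (x : ℕ) % (b + 1) = i).card =
      n / (b + 1) + if i < n % (b + 1) then 1 else 0 := by
  have h := Nat.count_modEq_card n (Nat.succ_pos b) i
  rw [Nat.succ_eq_add_one, Nat.mod_eq_of_lt hi] at h
  rw [← h, Nat.count_eq_card_filter_range]
  refine Finset.card_bij (fun x _ => (x : ℕ)) ?_ (fun x _ y _ => Fin.ext) ?_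
  · intro x hx
    rw [Finset.mem_filter] at hx ⊢
    exact ⟨Finset.mem_range.2 x.2, hx.2.trans (Nat.mod_eq_of_lt hi).symm⟩
  · intro x hx
    rw [Finset.mem_filter, Finset.mem_range] at hx
    exact ⟨⟨x, hx.1⟩, Finset.mem_filter.2 ⟨Finset.mem_univ _, Eq.trans hx.2 (Nat.mod_eq_of_lt hi)⟩,
      rfl⟩

/-- For n = m + 1 vertices, ⌈n/(b + 1)⌉ is `m / (b + 1) + 1`, the order of the class of 0. When b +
1 divides n all classes have this order. -/
theorem hasStarSizes_turanConnected (m b : ℕ) :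
    HasStarSizes (fun x : Fin (m + 1) =>
      (⟨(x : ℕ) % (b + 1), Nat.mod_lt _ (Nat.succ_pos b)⟩ : Fin (b + 1))) 0 (m / (b + 1)) := by
  have hsucc : (m + 1) / (b + 1) = m / (b + 1) + if (m + 1) % (b + 1) = 0 then 1 else 0 := by
    rw [Nat.succ_div]
    simp only [Nat.dvd_iff_mod_eq_zero]
  simp only [HasStarSizes, Fin.ext_iff, Fin.val_zero]
  refine ⟨?_, fun i => ?_⟩
  · rw [card_filter_mod_eq (Nat.succ_pos b), hsucc]
    rcases Nat.eq_zero_or_pos ((m + 1) % (b + 1)) with h | h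
    · simp [h]
    · simp [h, h.ne']
  · rw [card_filter_mod_eq i.2, hsucc]
    rcases Nat.eq_zero_or_pos ((m + 1) % (b + 1)) with h | h
    · simp [h]
    · simp only [h.ne', if_false, add_zero]
      split_ifs <;> simp

theorem fTC_eq_turanConnectedCount {m b : ℕ} (h : b ≤ m) :
    fTC (m + 1) (b + 1) = turanConnectedCount m b := by
  rw [fTC, fibonacciIndex_eq_stableCount]
  exact (isCliqueStar_turanConnected (Nat.succ_le_succ h)).stableCount_eq
    (hasStarSizes_turanConnected m b) (by simp) (by simp)

theorem fibonacciIndex_cycleGraph_five : fibonacciIndex (SimpleGraph.cycleGraph 5) = 11 := by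
  rw [fibonacciIndex, Nat.card_congr (Equiv.subtypeEquivRight (q := fun s : Finset (Fin 5) =>
    ∀ a ∈ s, ∀ b ∈ s, ¬(a - b = 1 ∨ b - a = 1)) fun s => ?_), Nat.card_eq_fintype_card]
  · decide
  · simp only [← SimpleGraph.cycleGraph_adj]
    refine ⟨fun h a ha b hb hab => h ha hb hab.ne hab, fun h a ha b hb _ => h a ha b hb⟩

theorem fTC_five_two : fTC 5 2 = 11 := by
  rw [fTC_eq_turanConnectedCount (m := 4) (b := 1) (by omega)]
  decide

theorem theorem4p3 {V : Type*} [Fintype V] (G : SimpleGraph V) (hG : G.Connected)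
    (n α : ℕ) (hn : Fintype.card V = n) (hα : G.indepNum = α) :
    fibonacciIndex G ≤ fTC n α ∧
    ((n, α) ≠ (5, 2) →
      (fibonacciIndex G = fTC n α ↔ Nonempty (G ≃g turanConnected n α))) ∧
    ((n, α) = (5, 2) →
      (fibonacciIndex G = fTC n α ↔
        Nonempty (G ≃g turanConnected 5 2) ∨ Nonempty (G ≃g SimpleGraph.cycleGraph 5))) := by
  classical
  have hconn := hG.isConnectedOn
  rw [indepNum_eq_stabilityOn] at hα
  have hα0 := stabilityOn_pos (G := G) hconn.1
  have hαn := stabilityOn_le_card (G := G) (W := Finset.univ)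
  rw [Finset.card_univ] at hαn
  obtain ⟨m, rfl⟩ : ∃ m, n = m + 1 := ⟨n - 1, by omega⟩
  obtain ⟨b, rfl⟩ : ∃ b, α = b + 1 := ⟨α - 1, by omega⟩
  obtain ⟨hle, heq⟩ := connected_bound hconn (by rwa [Finset.card_univ]) hα
  rw [← fibonacciIndex_eq_stableCount, ← fTC_eq_turanConnectedCount (by omega)] at hle heq
  have hcases : fibonacciIndex G = fTC (m + 1) (b + 1) →
      Nonempty (G ≃g turanConnected (m + 1) (b + 1)) ∨
        b = 1 ∧ m = 4 ∧ Nonempty (G ≃g SimpleGraph.cycleGraph 5) := by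
    intro h
    rcases heq h with ⟨v, -, hv⟩ | ⟨hb, hp⟩
    · obtain ⟨c, r, h, hstar, hsizes⟩ := exists_isCliqueStar hconn hn hα hv
      exact Or.inl (hstar.nonempty_iso (isCliqueStar_turanConnected (by omega)) hsizes
        (hasStarSizes_turanConnected m b) (by simpa using hn))
    · have := hp.card_eq
      rw [Finset.card_univ] at this
      exact Or.inr ⟨hb, by omega, hp.nonempty_iso⟩
  refine ⟨hle, fun hne => ⟨fun h => ?_, fun ⟨e⟩ => fibonacciIndex_congr e⟩,
    fun h52 => ?_⟩
  · rcases hcases h with h | ⟨rfl, rfl, -⟩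
    · exact h
    · exact absurd rfl hne
  · obtain ⟨rfl, rfl⟩ : m = 4 ∧ b = 1 := by simpa using h52
    refine ⟨fun h => (hcases h).imp_right fun h => h.2.2, ?_⟩
    rintro (⟨⟨e⟩⟩ | ⟨⟨e⟩⟩)
    · exact fibonacciIndex_congr e
    · rw [fibonacciIndex_congr e, fibonacciIndex_cycleGraph_five]
      exact fTC_five_two.symm
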